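/- A (left) skew brace is a set $B$ with two group structures $(B,\cdot)$ (its additive group, not necessarily abelian) and $(B,\circ)$ (its multiplicative group) such that $a\circ(b\cdot c)=(a\circ b)\cdot a^{-1}\cdot(a\circ c)$ for all $a,b,c\in B$, where $a^{-1}$ is the inverse of $a$ in $(B,\cdot)$. Its order is $|B|$. A homomorphism of skew braces is a map preserving both operations, and $\mathrm{Aut}_{\mathrm{sb}}(B)$ is the group of skew brace automorphisms of $B$. The opposite skew brace $B^{\mathrm{opp}}$ is $(B,\cdot^{\mathrm{opp}},\circ)$ with $a\cdot^{\mathrm{opp}}b=b\cdot a$. An ideal of $B$ is a subgroup $I$ of $(B,\cdot)$ with $a^{-1}\cdot(a\circ x)\in I$ for all $a\in B$, $x\in I$ (such an $I$ is also a subgroup of $(B,\circ)$) that is normal in both $(B,\cdot)$ and $(B,\circ)$. The skew brace $B$ is simple if $|B|>1$ and its only ideals are $\{1\}$ and $B$. Let $C_m$ denote the cyclic group of order $m$. **Theorem.** Let $p$ and $q$ be primes such that $q$ divides $(p^p-1)/(p-1)$, and let $n=p^pq$. 1. There is a simple skew brace $B$ of order $n$ such that $B^{\mathrm{opp}}$ is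 also simple of order $n$, $B\not\cong B^{\mathrm{opp}}$, and every simple skew brace of order $n$ is isomorphic to $B$ or to $B^{\mathrm{opp}}$. Thus, up to isomorphism, there are exactly two simple skew braces of order $n$, and they are opposite to each other. 2. There is a nontrivial action of $C_q$ on $C_p^p$ by automorphisms such that the additive group of every simple skew brace of order $n$ is isomorphic to the corresponding semidirect product $C_p^p\rtimes C_q$. 3. There are a group $P$ of order $p^p$ and an action $\psi:P\to\mathrm{Aut}(C_q)$ whose image is the cyclic group generated by an automorphism of order $p$, such that the multiplicative group of every simple skew brace of order $n$ is isomorphic to the corresponding semidirect product $C_q\rtimes P$. 4. For every simple skew brace $C$ of order $n$, the group $\mathrm{Aut}_{\mathrm{sb}}(C)$ is cyclic of order $p$. -/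

import Mathlib

/-- A (left) skew brace: one set with two group structures. The "additive" group `(B, ·)` of the
literature, which need not be commutative, is written `+` here; the "multiplicative" group `(B, ∘)`
is written `*`. The brace relation `a ∘ (b · c) = (a ∘ b) · a⁻¹ · (a ∘ c)`, with the inverse taken in
`(B, ·)`, links the two.

A skew brace isomorphism is a bijection that preserves both operations, that is, a term of Mathlib's
`B ≃+* C` (which needs no ring axioms), and the automorphism group of `B` is `RingAut B`. -/
class SkewBrace (B : Type*) extends AddGroup B, Group B where
  brace_relation : ∀ a b c : B, a * (b + c) = a * b + -a + a * c

namespace SkewBrace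

variable {B : Type*} [SkewBrace B]

/-- The map `λ_a : b ↦ a⁻¹ · (a ∘ b)`. -/
def lam (a b : B) : B := -a + a * b

theorem mul_zero_eq (a : B) : a * 0 = a := by
  have h := brace_relation a 0 0
  rw [add_zero, add_assoc] at h
  have h2 : -a + a * 0 = 0 := by
    have h3 : a * 0 + 0 = a * 0 + (-a + a * 0) := by rw [add_zero]; exact h
    exact (add_left_cancel h3).symm
  exact (neg_add_eq_zero.mp h2).symm

theorem one_eq_zero : (1 : B) = 0 := by
  rw [← mul_zero_eq (1 : B), one_mul]

/-- A left ideal: a subgroup of `(B, ·)` stable under all the maps `λ_a`. -/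
structure IsLeftIdeal (I : AddSubgroup B) : Prop where
  lam_mem : ∀ a : B, ∀ b ∈ I, lam a b ∈ I

/-- A left ideal, as a subgroup of `(B, ∘)`. -/
def IsLeftIdeal.toSubgroup {I : AddSubgroup B} (h : IsLeftIdeal I) : Subgroup B where
  carrier := I
  one_mem' := by rw [one_eq_zero]; exact I.zero_mem
  mul_mem' := by
    intro a b ha hb
    have h1 := I.add_mem ha (h.lam_mem a b hb)
    rwa [lam, add_neg_cancel_left] at h1
  inv_mem' := by
    intro a ha
    have h1 := h.lam_mem a⁻¹ a ha
    rw [lam, inv_mul_cancel, one_eq_zero, add_zero] at h1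
    exact I.neg_mem_iff.mp h1

/-- An ideal: a left ideal that is a normal subgroup of both `(B, ·)` and `(B, ∘)`. -/
structure IsIdeal (I : AddSubgroup B) : Prop extends IsLeftIdeal I where
  normal_add : I.Normal
  normal_mul : toIsLeftIdeal.toSubgroup.Normal

variable (B) in
/-- `B` is simple: it has more than one element, and its only ideals are the trivial ones. -/
structure IsSimple : Prop where
  nontrivial : Nontrivial B
  eq_bot_or_eq_top : ∀ I : AddSubgroup B, IsIdeal I → I = ⊥ ∨ I = ⊤

/-- The opposite skew brace: `a ·ᵒᵖ b = b · a`, with `∘` unchanged. Mathlib's `Bᵃᵒᵖ` is a copy of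
`B` with the addition reversed and the multiplication unchanged. -/
instance instAddOpposite : SkewBrace Bᵃᵒᵖ where
  toAddGroup := inferInstance
  toGroup := inferInstance
  brace_relation a b c := by
    apply AddOpposite.unop_injective
    simp only [AddOpposite.unop_mul, AddOpposite.unop_add, AddOpposite.unop_neg,
      brace_relation, add_assoc]

end SkewBrace

universe u

/-!
The skew braces in question live on `F × μ`, where `F` is the field of order `p ^ p` and `μ` is the
group of `q`-th roots of unity in it. Since `p` has order `p` modulo `q`, each nontrivial element of
`μ` generates `F` as a ring, and the Frobenius automorphism `σ`, of order `p`, acts faithfully on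
`μ`. The model `TraceBrace p q` has the additive group `F ⋊ μ` and the multiplication
`(x, u) ∘ (y, v) = (x + σ ^ t y, u * σ ^ t v)` with `t` the trace of `x`. It is simple
(`TraceBrace.isSimple`): an ideal other than `0` contains `F`, which is not normal for `∘`.

Conversely, let `B` be a simple skew brace of order `p ^ p * q`. By Sylow's theorem and Burnside's
transfer, each of its two groups has a normal Sylow subgroup (`exists_normal_card`); a normal Sylow
subgroup of the additive group is a left ideal, so by simplicity it cannot be normal in the
multiplicative group. One finds (`IsSimple.not_exists_normal_card_prime`) that the additive group
has a normal subgroup `P` of order `p ^ p` and none of order `q`, and that the multiplicative group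
has a normal subgroup `Q` of order `q` and none of order `p ^ p`. The fixed points of `λ` on `Q`
form a left ideal, equal to `Q` or to `B`; comparing with the opposite skew brace, one sees that up
to passing to the opposite, `Q` is a left ideal and `z ∘ b = b · z` for `z` in `Q`
(`IsSimple.hasRightTranslations_or`).

An element of order `q` acts irreducibly on `P`, so the ring generated by this action is a field of
order `p ^ p` and `P` is a line over it (`exists_coordinates`). For `x` in `P`, the map `λ_x`
normalizes the action of `Q` and is therefore semilinear; with a fixed vector of `P` as basis it
becomes `σ ^ f x`. The function `f` satisfies a cocycle identity that forces it to be a nonzero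
multiple of the trace (`exists_eq_trace_of_cocycle`), and rescaling the basis vector makes it the
trace itself. So `B` is the model (`IsSimple.nonempty_iso`).

The remaining assertions are computations in the model. In particular an automorphism has a
semilinear component on `F` that preserves the trace and commutes with `σ`, so it is a power of `σ`
(`TraceBrace.exists_frobAut_eq`).
-/

open SkewBrace

/-! ### Arithmetic of the pair `(p, q)` -/

section Arithmetic

variable {p q : ℕ}

theorem orderOf_natCast_of_dvd [Fact p.Prime] [Fact q.Prime]
    (h : q ∣ (p ^ p - 1) / (p - 1)) : orderOf (p : ZMod q) = p := by
  have hp := (Fact.out : p.Prime)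
  have hgeom : (p ^ p - 1) / (p - 1) = ∑ i ∈ Finset.range p, p ^ i :=
    (Nat.geomSum_eq hp.two_le p).symm
  have hsum : ∑ i ∈ Finset.range p, (p : ZMod q) ^ i = 0 := by
    rw [hgeom, ← ZMod.natCast_eq_zero_iff] at h
    simpa using h
  have hpow : (p : ZMod q) ^ p = 1 := by
    have := geom_sum_mul (p : ZMod q) p
    rw [hsum, zero_mul] at this
    exact (sub_eq_zero.mp this.symm)
  refine orderOf_eq_prime hpow fun h1 => ?_
  simp [h1] at hsum

theorem natCast_ne_zero_of_orderOf [Fact p.Prime] (hord : orderOf (p : ZMod q) = p) [Fact q.Prime] :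
    (p : ZMod q) ≠ 0 := by
  intro h
  rw [h, orderOf_zero] at hord
  exact (Fact.out : p.Prime).ne_zero hord.symm

theorem ne_of_orderOf [Fact p.Prime] [Fact q.Prime] (hord : orderOf (p : ZMod q) = p) : p ≠ q := by
  rintro rfl
  exact natCast_ne_zero_of_orderOf hord (by simp)

theorem coprime_of_orderOf [Fact p.Prime] [Fact q.Prime] (hord : orderOf (p : ZMod q) = p) (k : ℕ) :
    (p ^ k).Coprime q :=
  Nat.Coprime.pow_left _ ((Nat.coprime_primes Fact.out Fact.out).2 (ne_of_orderOf hord))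

theorem pow_modEq_one [Fact p.Prime] (hord : orderOf (p : ZMod q) = p) :
    p ^ p ≡ 1 [MOD q] := by
  rw [← ZMod.natCast_eq_natCast_iff]
  have := pow_orderOf_eq_one (p : ZMod q)
  rw [hord] at this
  simpa using this

theorem eq_one_or_eq_pow_of_modEq_one [Fact p.Prime] (hord : orderOf (p : ZMod q) = p) {m : ℕ}
    (hm : m ∣ p ^ p) (h : m ≡ 1 [MOD q]) : m = 1 ∨ m = p ^ p := by
  have hp := (Fact.out : p.Prime)
  obtain ⟨k, hk, rfl⟩ := (Nat.dvd_prime_pow hp).1 hm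
  rw [← ZMod.natCast_eq_natCast_iff] at h
  push_cast at h
  have := orderOf_dvd_of_pow_eq_one h
  rw [hord] at this
  rcases Nat.eq_zero_or_pos k with rfl | hpos
  · simp
  · right
    rw [le_antisymm hk (Nat.le_of_dvd hpos this)]

theorem lt_pow_of_orderOf [Fact p.Prime] (hord : orderOf (p : ZMod q) = p) : q < p ^ p := by
  have hp := (Fact.out : p.Prime)
  have h1 : 1 < p ^ p := Nat.one_lt_pow hp.ne_zero hp.one_lt
  have := (Nat.modEq_iff_dvd' h1.le).1 (pow_modEq_one hord).symm
  have := Nat.le_of_dvd (by omega) this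
  omega

theorem card_modEq_card_fixed [Fact q.Prime] {X : Type*} [Finite X] (f : X → X)
    (hf : f^[q] = id) : Nat.card X ≡ Nat.card {x // f x = x} [MOD q] := by
  classical
  have := Fintype.ofFinite X
  have h := Equiv.Perm.card_fixedPoints_modEq (f := (f : Function.End X)) (p := q) (n := 1) (by
    rw [pow_one]
    exact (hom_coe_pow (fun g : Function.End X => g) rfl (fun g h => rfl) f q).trans hf)
  rw [← Nat.card_eq_fintype_card, ← Nat.card_eq_fintype_card] at h
  exact h

/-- A permutation of prime order `q` with exactly one fixed point acts on a set whose size is `1`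
modulo `q`. -/
theorem card_modEq_one_of_unique_fixed [Fact q.Prime] {X : Type*} [Finite X] (f : X → X)
    (hf : f^[q] = id) (x₀ : X) (hx : ∀ x, f x = x ↔ x = x₀) : Nat.card X ≡ 1 [MOD q] := by
  have h := card_modEq_card_fixed f hf
  simp only [hx] at h
  simpa using h

end Arithmetic

/-! ### Groups of order `p ^ p * q` -/

section Groups

variable {p q : ℕ} {H : Type*} [Group H]

/-- A normal Hall subgroup contains every subgroup whose order is prime to its index. -/
theorem Subgroup.le_of_coprime_index [Finite H] {N K : Subgroup H} [N.Normal]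
    (h : (Nat.card K).Coprime N.index) : K ≤ N := by
  intro k hk
  rw [← QuotientGroup.eq_one_iff, ← orderOf_eq_one_iff]
  refine Nat.eq_one_of_dvd_coprimes h ?_ ?_
  · exact (orderOf_map_dvd (QuotientGroup.mk' N) k).trans (K.orderOf_dvd_natCard hk)
  · exact _root_.orderOf_dvd_natCard (G := H ⧸ N) _

theorem Subgroup.eq_of_card_eq_of_coprime_index [Finite H] {N K : Subgroup H} [N.Normal]
    (hc : Nat.card K = Nat.card N) (h : (Nat.card N).Coprime N.index) : K = N :=
  Subgroup.eq_of_le_of_card_ge (Subgroup.le_of_coprime_index (hc ▸ h)) hc.ge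

theorem Subgroup.characteristic_of_coprime_index [Finite H] {N : Subgroup H} [N.Normal]
    (h : (Nat.card N).Coprime N.index) : N.Characteristic := by
  rw [Subgroup.characteristic_iff_map_eq]
  intro φ
  refine Subgroup.eq_of_card_eq_of_coprime_index ?_ h
  exact Nat.card_congr (N.equivMapOfInjective φ.toMonoidHom φ.injective).toEquiv.symm

theorem natCard_dvd_index_of_inf_eq_bot {N K : Subgroup H} [N.Normal]
    (h : K ⊓ N = ⊥) : Nat.card K ∣ N.index := by
  rw [← Subgroup.relIndex_bot_left, ← h, inf_comm, Subgroup.inf_relIndex_right]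
  exact Subgroup.relIndex_dvd_index_of_normal N K

theorem index_of_card_pow [Fact p.Prime] (hH : Nat.card H = p ^ p * q) {N : Subgroup H}
    (hN : Nat.card N = p ^ p) : N.index = q := by
  have := N.card_mul_index
  rw [hN, hH] at this
  exact Nat.eq_of_mul_eq_mul_left (pow_pos (Fact.out : p.Prime).pos _) this

theorem index_of_card_prime [Fact q.Prime] (hH : Nat.card H = p ^ p * q) {N : Subgroup H}
    (hN : Nat.card N = q) : N.index = p ^ p := by
  have := N.card_mul_index
  rw [hN, hH, mul_comm] at this
  exact Nat.eq_of_mul_eq_mul_right (Fact.out : q.Prime).pos this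

variable [Fact p.Prime] [Fact q.Prime]

omit [Group H] in
theorem finite_of_card (hH : Nat.card H = p ^ p * q) : Finite H :=
  Nat.finite_of_card_ne_zero (hH ▸ (mul_pos (pow_pos (Fact.out : p.Prime).pos _)
    (Fact.out : q.Prime).pos).ne')

/-- Burnside's transfer theorem for a subgroup of order `q` whose normalizer centralizes it. -/
theorem exists_normal_of_normalizer_le (hord : orderOf (p : ZMod q) = p)
    (hH : Nat.card H = p ^ p * q) {Q : Subgroup H} (hQ : Nat.card Q = q)
    (hc : Subgroup.normalizer (Q : Set H) ≤ Subgroup.centralizer (Q : Set H)) :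
    ∃ N : Subgroup H, N.Normal ∧ Nat.card N = p ^ p := by
  have := finite_of_card hH
  have hfac : (Nat.card H).factorization q = 1 := by
    rw [hH, Nat.factorization_mul (pow_pos (Fact.out : p.Prime).pos _).ne'
      (Fact.out : q.Prime).ne_zero, Nat.Prime.factorization_pow Fact.out,
      Nat.Prime.factorization Fact.out]
    simp [ne_of_orderOf hord]
  let S : Sylow q H := Sylow.ofCard Q (by rw [hQ, hfac, pow_one])
  refine ⟨(MonoidHom.transferSylow S hc).ker, inferInstance, ?_⟩
  have := (MonoidHom.ker_transferSylow_isComplement' S hc).card_mul_card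
  rw [hH] at this
  have hS : Nat.card S = q := hQ
  rw [hS] at this
  exact Nat.eq_of_mul_eq_mul_right (Fact.out : q.Prime).pos this

/-- The number of Sylow `q`-subgroups is `1` or `p ^ p`, and in the second case they are
self-normalizing, hence central in their normalizers. -/
theorem exists_normal_card (hord : orderOf (p : ZMod q) = p) (hH : Nat.card H = p ^ p * q) :
    (∃ N : Subgroup H, N.Normal ∧ Nat.card N = q) ∨
      ∃ N : Subgroup H, N.Normal ∧ Nat.card N = p ^ p := by
  have := finite_of_card hH
  obtain ⟨Q, hQ⟩ := Sylow.exists_subgroup_card_pow_prime (G := H) q (n := 1)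
    (by rw [hH, pow_one]; exact dvd_mul_left _ _)
  rw [pow_one] at hQ
  have hfac : (Nat.card H).factorization q = 1 := by
    rw [hH, Nat.factorization_mul (pow_pos (Fact.out : p.Prime).pos _).ne'
      (Fact.out : q.Prime).ne_zero, Nat.Prime.factorization_pow Fact.out,
      Nat.Prime.factorization Fact.out]
    simp [ne_of_orderOf hord]
  let S : Sylow q H := Sylow.ofCard Q (by rw [hQ, hfac, pow_one])
  have h1 := card_sylow_modEq_one q H
  rw [S.card_eq_index_normalizer] at h1
  change (Subgroup.normalizer (Q : Set H)).index ≡ 1 [MOD q] at h1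
  have hle : Q ≤ Subgroup.normalizer (Q : Set H) := Subgroup.le_normalizer
  have h2 : (Subgroup.normalizer (Q : Set H)).index ∣ p ^ p := by
    rw [← index_of_card_prime hH hQ]
    exact Subgroup.index_dvd_of_le hle
  rcases eq_one_or_eq_pow_of_modEq_one hord h2 h1 with h | h
  · left
    rw [Subgroup.index_eq_one] at h
    exact ⟨Q, Subgroup.normalizer_eq_top_iff.1 h, hQ⟩
  · right
    refine exists_normal_of_normalizer_le hord hH hQ ?_
    have h3 := (Subgroup.normalizer (Q : Set H)).card_mul_index
    rw [h, hH, mul_comm] at h3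
    have h4 := Nat.eq_of_mul_eq_mul_left (pow_pos (Fact.out : p.Prime).pos _) h3
    have h5 : Q = Subgroup.normalizer (Q : Set H) :=
      Subgroup.eq_of_le_of_card_ge hle (by rw [h4, hQ])
    rw [← h5]
    have : IsCyclic Q := isCyclic_of_prime_card hQ
    have : IsMulCommutative Q := inferInstance
    exact Subgroup.le_centralizer Q

omit [Fact p.Prime] [Fact q.Prime] in
theorem coe_iterate_conj {M : Subgroup H} {z : H} (hM : ∀ x ∈ M, z * x * z⁻¹ ∈ M) (n : ℕ) (x : M) :
    (((fun x : M => (⟨z * x * z⁻¹, hM x x.2⟩ : M))^[n] x : M) : H) = z ^ n * x * (z ^ n)⁻¹ := by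
  induction n with
  | zero => simp
  | succ n ih =>
    rw [Function.iterate_succ_apply']
    simp only [ih]
    group

/-- If there is no normal subgroup of order `q`, an element of order `q` centralizes no element of
the normal subgroup of order `p ^ p` except `1`. -/
theorem eq_one_of_commute_of_orderOf (hord : orderOf (p : ZMod q) = p)
    (hH : Nat.card H = p ^ p * q)
    (hno : ¬ ∃ N : Subgroup H, N.Normal ∧ Nat.card N = q) {N : Subgroup H} [hNn : N.Normal]
    (hN : Nat.card N = p ^ p) {z : H} (hz : orderOf z = q) {x : H} (hx : x ∈ N)
    (hc : z * x = x * z) : x = 1 := by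
  have := finite_of_card hH
  -- the centralizer of `z` in `N` has order congruent to `|N|`, that is to `1`, modulo `q`
  let D : Subgroup H := N ⊓ Subgroup.centralizer {z}
  have h := card_modEq_card_fixed (q := q) (fun x : N => ⟨z * x * z⁻¹, hNn.conj_mem x x.2 z⟩) (by
    ext x
    rw [coe_iterate_conj (fun x hx => hNn.conj_mem x hx z), ← hz, pow_orderOf_eq_one]
    simp)
  have hD : Nat.card D = Nat.card {x : N // (⟨z * x * z⁻¹, hNn.conj_mem x x.2 z⟩ : N) = x} := by
    refine Nat.card_congr ⟨fun d => ⟨⟨d, d.2.1⟩, Subtype.ext ?_⟩, fun d => ⟨d.1, d.1.2, ?_⟩,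
      fun _ => rfl, fun _ => rfl⟩
    · exact mul_inv_eq_iff_eq_mul.2 (Subgroup.mem_centralizer_singleton_iff.1 d.2.2).symm
    · exact Subgroup.mem_centralizer_singleton_iff.2
        (mul_inv_eq_iff_eq_mul.1 (congrArg Subtype.val d.2)).symm
  have h1 : Nat.card D ≡ 1 [MOD q] := by
    rw [hD]
    exact h.symm.trans (hN ▸ pow_modEq_one hord)
  have hDd : Nat.card D ∣ p ^ p := hN ▸ Subgroup.card_dvd_of_le inf_le_left
  rcases eq_one_or_eq_pow_of_modEq_one hord hDd h1 with h2 | h2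
  · have h3 := Subgroup.card_eq_one.1 h2
    have : x ∈ D := ⟨hx, Subgroup.mem_centralizer_singleton_iff.2 hc.symm⟩
    rwa [h3, Subgroup.mem_bot] at this
  · -- otherwise `z` centralizes `N` and generates a normal subgroup of order `q`
    exfalso
    have h3 : D = N := Subgroup.eq_of_le_of_card_ge inf_le_left (by rw [h2, hN])
    have h4 : N ≤ Subgroup.centralizer {z} := h3 ▸ inf_le_right
    have hzc : Subgroup.centralizer {z} = (⊤ : Subgroup H) := by
      rw [← Subgroup.card_eq_iff_eq_top]
      apply Nat.dvd_antisymm (Subgroup.card_subgroup_dvd_card _)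
      rw [hH]
      refine Nat.Coprime.mul_dvd_of_dvd_of_dvd (coprime_of_orderOf hord p) ?_ ?_
      · rw [← hN]
        exact Subgroup.card_dvd_of_le h4
      · rw [← hz]
        exact Subgroup.orderOf_dvd_natCard _ (Subgroup.mem_centralizer_singleton_iff.2 rfl)
    refine hno ⟨Subgroup.zpowers z, ⟨?_⟩, by rw [Nat.card_zpowers, hz]⟩
    intro n hn g
    have hg : g ∈ Subgroup.centralizer {z} := hzc ▸ Subgroup.mem_top g
    obtain ⟨k, rfl⟩ := Subgroup.mem_zpowers_iff.1 hn
    have hg := Subgroup.mem_centralizer_singleton_iff.1 hg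
    have : Commute g z := hg
    rw [(this.zpow_right k).eq, mul_inv_cancel_right]
    exact hn

/-- If there is no normal subgroup of order `q`, an element of order `q` acts irreducibly on the
normal subgroup of order `p ^ p`. -/
theorem eq_bot_or_eq_of_conj_mem (hord : orderOf (p : ZMod q) = p)
    (hH : Nat.card H = p ^ p * q)
    (hno : ¬ ∃ N : Subgroup H, N.Normal ∧ Nat.card N = q) {N : Subgroup H} [hNn : N.Normal]
    (hN : Nat.card N = p ^ p) {z : H} (hz : orderOf z = q) {M : Subgroup H} (hMN : M ≤ N)
    (hM : ∀ x ∈ M, z * x * z⁻¹ ∈ M) : M = ⊥ ∨ M = N := by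
  have := finite_of_card hH
  let f : M → M := fun x => ⟨z * x * z⁻¹, hM x x.2⟩
  have h1 : Nat.card M ≡ 1 [MOD q] := by
    refine card_modEq_one_of_unique_fixed f ?_ 1 fun x => ⟨fun h => ?_, fun h => ?_⟩
    · ext x
      rw [coe_iterate_conj, ← hz, pow_orderOf_eq_one]
      simp
    · have h := congrArg Subtype.val h
      change z * (x : H) * z⁻¹ = x at h
      exact Subtype.ext (eq_one_of_commute_of_orderOf hord hH hno hN hz (hMN x.2)
        (mul_inv_eq_iff_eq_mul.1 h))
    · subst h
      refine Subtype.ext ?_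
      change z * 1 * z⁻¹ = 1
      simp
  rcases eq_one_or_eq_pow_of_modEq_one hord (hN ▸ Subgroup.card_dvd_of_le hMN) h1 with h | h
  · exact .inl (Subgroup.card_eq_one.1 h)
  · exact .inr (Subgroup.eq_of_le_of_card_ge hMN (by rw [h, hN]))

theorem exists_orderOf_eq (hH : Nat.card H = p ^ p * q) : ∃ z : H, orderOf z = q := by
  have := finite_of_card hH
  exact exists_prime_orderOf_dvd_card' q (hH ▸ dvd_mul_left _ _)

/-- The elements of order dividing `p` in the centre of the `p`-subgroup form an invariant
nontrivial subgroup, hence everything. -/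
theorem commute_and_pow_eq_one (hord : orderOf (p : ZMod q) = p)
    (hH : Nat.card H = p ^ p * q)
    (hno : ¬ ∃ N : Subgroup H, N.Normal ∧ Nat.card N = q) {N : Subgroup H} [hNn : N.Normal]
    (hN : Nat.card N = p ^ p) : (∀ x ∈ N, ∀ y ∈ N, x * y = y * x) ∧ ∀ x ∈ N, x ^ p = 1 := by
  have := finite_of_card hH
  have hp := (Fact.out : p.Prime)
  obtain ⟨z, hz⟩ := exists_orderOf_eq hH
  let M : Subgroup H :=
    { carrier := {x | x ∈ N ∧ (∀ y ∈ N, x * y = y * x) ∧ x ^ p = 1}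
      one_mem' := ⟨N.one_mem, by simp, by simp⟩
      mul_mem' := by
        rintro a b ⟨ha, ha1, ha2⟩ ⟨hb, hb1, hb2⟩
        refine ⟨N.mul_mem ha hb, fun y hy => ?_, ?_⟩
        · rw [mul_assoc, hb1 y hy, ← mul_assoc, ha1 y hy, mul_assoc]
        · rw [Commute.mul_pow (ha1 b hb), ha2, hb2, one_mul]
      inv_mem' := by
        rintro a ⟨ha, ha1, ha2⟩
        refine ⟨N.inv_mem ha, fun y hy => ?_, by rw [inv_pow, ha2, inv_one]⟩
        have : Commute a y := ha1 y hy
        exact this.inv_left.eq }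
  have hM : M = ⊥ ∨ M = N := by
    refine eq_bot_or_eq_of_conj_mem hord hH hno hN hz (fun x hx => hx.1) ?_
    rintro x ⟨hx, hx1, hx2⟩
    refine ⟨hNn.conj_mem x hx z, fun y hy => ?_, by rw [conj_pow, hx2]; simp⟩
    have h1 := hx1 (z⁻¹ * y * z) (by simpa using hNn.conj_mem y hy z⁻¹)
    calc z * x * z⁻¹ * y = z * (x * (z⁻¹ * y * z)) * z⁻¹ := by group
      _ = y * (z * x * z⁻¹) := by rw [h1]; group
  rcases hM with hM | hM
  · exfalso
    have hpg : IsPGroup p N := IsPGroup.of_card hN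
    have : Nontrivial N := by
      rw [← Finite.one_lt_card_iff_nontrivial, hN]
      exact Nat.one_lt_pow hp.ne_zero hp.one_lt
    have hnt := hpg.center_nontrivial
    have hd := (hpg.to_subgroup (Subgroup.center N)).card_eq_or_dvd
    rcases hd with hd | hd
    · rw [← Finite.one_lt_card_iff_nontrivial] at hnt
      omega
    · obtain ⟨c, hc⟩ := exists_prime_orderOf_dvd_card' p hd
      have hcM : ((c : N) : H) ∈ M := by
        refine ⟨c.1.2, fun y hy => ?_, ?_⟩
        · exact (congrArg Subtype.val (Subgroup.mem_center_iff.1 c.2 ⟨y, hy⟩)).symm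
        · have := pow_orderOf_eq_one c
          rw [hc] at this
          simpa using congrArg (fun c : Subgroup.center N => ((c : N) : H)) this
      rw [hM, Subgroup.mem_bot] at hcM
      have : c = 1 := Subtype.ext (Subtype.ext hcM)
      rw [this, orderOf_one] at hc
      exact hp.ne_one hc.symm
  · constructor
    · intro x hx
      rw [← hM] at hx
      exact hx.2.1
    · intro x hx
      rw [← hM] at hx
      exact hx.2.2

/-- The same as `eq_one_of_commute_of_orderOf` for any element outside the normal subgroup. -/
theorem eq_one_of_commute (hord : orderOf (p : ZMod q) = p)
    (hH : Nat.card H = p ^ p * q)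
    (hno : ¬ ∃ N : Subgroup H, N.Normal ∧ Nat.card N = q) {N : Subgroup H} [hNn : N.Normal]
    (hN : Nat.card N = p ^ p) {z : H} (hz : z ∉ N) {x : H} (hx : x ∈ N)
    (hc : z * x = x * z) : x = 1 := by
  have := finite_of_card hH
  obtain ⟨w, hw⟩ := exists_orderOf_eq hH
  -- the centralizer of `x` contains `N` properly, and `N` has prime index
  have hle : N ≤ Subgroup.centralizer {x} := fun y hy =>
    Subgroup.mem_centralizer_singleton_iff.2 ((commute_and_pow_eq_one hord hH hno hN).1 y hy x hx)
  have hzx : z ∈ Subgroup.centralizer {x} := Subgroup.mem_centralizer_singleton_iff.2 hc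
  have hi : (Subgroup.centralizer {x}).index ∣ q := by
    rw [← index_of_card_pow hH hN]
    exact Subgroup.index_dvd_of_le hle
  rcases (Nat.dvd_prime Fact.out).1 hi with h | h
  · rw [Subgroup.index_eq_one] at h
    have hwx : w ∈ Subgroup.centralizer {x} := h ▸ Subgroup.mem_top w
    exact eq_one_of_commute_of_orderOf hord hH hno hN hw hx
      (Subgroup.mem_centralizer_singleton_iff.1 hwx)
  · exfalso
    have h1 := (Subgroup.centralizer {x}).card_mul_index
    rw [h, hH] at h1
    have h2 := Nat.eq_of_mul_eq_mul_right (Fact.out : q.Prime).pos h1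
    have h3 := Subgroup.eq_of_le_of_card_ge hle (by rw [h2, hN])
    exact hz (h3 ▸ hzx)

/-- Without a normal subgroup of order `q`, the centre is trivial. -/
theorem eq_one_of_forall_commute (hord : orderOf (p : ZMod q) = p)
    (hH : Nat.card H = p ^ p * q)
    (hno : ¬ ∃ N : Subgroup H, N.Normal ∧ Nat.card N = q) {z : H}
    (hc : ∀ x, z * x = x * z) : z = 1 := by
  have := finite_of_card hH
  have hp := (Fact.out : p.Prime)
  obtain ⟨N, hNn, hN⟩ := (exists_normal_card hord hH).resolve_left hno
  by_cases hz : z ∈ N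
  · obtain ⟨w, hw⟩ := exists_orderOf_eq hH
    exact eq_one_of_commute_of_orderOf hord hH hno hN hw hz (hc w).symm
  · exfalso
    have h1 : N = ⊥ := (Subgroup.eq_bot_iff_forall N).2 fun x hx =>
      eq_one_of_commute hord hH hno hN hz hx (hc x)
    rw [h1, Subgroup.card_bot] at hN
    exact (Nat.one_lt_pow hp.ne_zero hp.one_lt).ne hN

end Groups

/-! ### The field of order `p ^ p` -/

section Field

variable (p : ℕ) {q : ℕ} [Fact p.Prime]

theorem natCard_galoisField_self : Nat.card (GaloisField p p) = p ^ p :=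
  GaloisField.card p p (Fact.out : p.Prime).ne_zero

theorem orderOf_frobenius_galoisField :
    orderOf (FiniteField.frobeniusAlgEquivOfAlgebraic (ZMod p) (GaloisField p p)) = p := by
  rw [FiniteField.orderOf_frobeniusAlgEquivOfAlgebraic,
    GaloisField.finrank p (Fact.out : p.Prime).ne_zero]

variable {p}

/-- The power of the Frobenius automorphism of the field of order `p ^ p` with a given exponent;
the exponent lives in `ZMod p` because the Frobenius automorphism has order `p`. -/
noncomputable def frobPow (t : ZMod p) : Gal(GaloisField p p/ZMod p) :=
  FiniteField.frobeniusAlgEquivOfAlgebraic (ZMod p) (GaloisField p p) ^ t.val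

theorem frobPow_natCast (n : ℕ) : frobPow (n : ZMod p) =
    FiniteField.frobeniusAlgEquivOfAlgebraic (ZMod p) (GaloisField p p) ^ n := by
  rw [frobPow, ZMod.val_natCast]
  conv_rhs => rw [← pow_mod_orderOf, orderOf_frobenius_galoisField]

theorem frobPow_zero : frobPow (0 : ZMod p) = 1 := by
  rw [← Nat.cast_zero, frobPow_natCast, pow_zero]

theorem frobPow_add (s t : ZMod p) : frobPow (s + t) = frobPow s * frobPow t := by
  obtain ⟨m, rfl⟩ := ZMod.natCast_zmod_surjective s
  obtain ⟨n, rfl⟩ := ZMod.natCast_zmod_surjective t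
  rw [← Nat.cast_add, frobPow_natCast, frobPow_natCast, frobPow_natCast, pow_add]

theorem frobPow_add_apply (s t : ZMod p) (x : GaloisField p p) :
    frobPow (s + t) x = frobPow s (frobPow t x) := by
  rw [frobPow_add, AlgEquiv.mul_apply]

theorem frobPow_zero_apply (x : GaloisField p p) : frobPow (0 : ZMod p) x = x := by
  rw [frobPow_zero, AlgEquiv.one_apply]

theorem frobPow_neg_apply (t : ZMod p) (x : GaloisField p p) :
    frobPow (-t) (frobPow t x) = x := by
  rw [← frobPow_add_apply, neg_add_cancel, frobPow_zero_apply]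

theorem frobPow_apply_neg (t : ZMod p) (x : GaloisField p p) :
    frobPow t (frobPow (-t) x) = x := by
  rw [← frobPow_add_apply, add_neg_cancel, frobPow_zero_apply]

theorem frobPow_apply (t : ZMod p) (x : GaloisField p p) : frobPow t x = x ^ p ^ t.val := by
  rw [frobPow, AlgEquiv.coe_pow, FiniteField.coe_frobeniusAlgEquivOfAlgebraic_iterate, ZMod.card]

theorem frobPow_injective : Function.Injective (frobPow (p := p)) := by
  intro s t h
  rw [frobPow, frobPow, pow_inj_mod, orderOf_frobenius_galoisField,
    Nat.mod_eq_of_lt (ZMod.val_lt s), Nat.mod_eq_of_lt (ZMod.val_lt t)] at h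
  exact ZMod.val_injective p h

theorem exists_frobPow_eq (g : GaloisField p p →+* GaloisField p p) :
    ∃ t : ZMod p, ∀ x, g x = frobPow t x := by
  let g' : GaloisField p p →ₐ[ZMod p] GaloisField p p :=
    AlgHom.mk g fun r => DFunLike.congr_fun
      (Subsingleton.elim (g.comp (algebraMap (ZMod p) (GaloisField p p))) (algebraMap _ _)) r
  obtain ⟨n, hn⟩ := (FiniteField.bijective_frobeniusAlgHom_pow (ZMod p) (GaloisField p p)).2 g'
  refine ⟨(n : ℕ), fun x => ?_⟩
  have h := DFunLike.congr_fun hn x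
  rw [frobPow_natCast, AlgEquiv.coe_pow, FiniteField.coe_frobeniusAlgEquivOfAlgebraic_iterate]
  change _ = g x at h
  rw [← h, AlgHom.coe_pow, FiniteField.coe_frobeniusAlgHom, pow_iterate]

theorem frobPow_algebraMap (t c : ZMod p) :
    frobPow t (algebraMap (ZMod p) (GaloisField p p) c) = algebraMap _ _ c :=
  AlgEquiv.commutes _ _

theorem trace_frobPow (t : ZMod p) (x : GaloisField p p) :
    Algebra.trace (ZMod p) (GaloisField p p) (frobPow t x) =
      Algebra.trace (ZMod p) (GaloisField p p) x :=
  Algebra.trace_eq_of_algEquiv (frobPow t) x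

/-- The elements fixed by the Frobenius automorphism are the elements of the prime field. -/
theorem exists_algebraMap_eq {x : GaloisField p p} (h : frobPow 1 x = x) :
    ∃ c : ZMod p, algebraMap (ZMod p) (GaloisField p p) c = x := by
  rw [← Nat.cast_one, frobPow_natCast, pow_one] at h
  have hx := (IsGalois.mem_bot_iff_fixed (F := ZMod p) x).2 (fun f => ?_)
  · exact IntermediateField.mem_bot.1 hx
  · obtain ⟨n, hn⟩ :=
      (FiniteField.bijective_frobeniusAlgEquivOfAlgebraic_pow (ZMod p) (GaloisField p p)).2 f
    rw [← hn]
    change (FiniteField.frobeniusAlgEquivOfAlgebraic (ZMod p) (GaloisField p p) ^ n.1) x = x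
    rw [AlgEquiv.coe_pow]
    exact Function.iterate_fixed h n.1

theorem trace_surjective_galoisField :
    Function.Surjective (Algebra.trace (ZMod p) (GaloisField p p)) :=
  Algebra.trace_surjective _ _

variable [Fact q.Prime]

/-- A set whose size divides `p ^ p`, with a self-map of order `q` whose only fixed point is `0`, has
size `1` or `p ^ p`. -/
theorem card_eq_of_iterate_eq_id (hord : orderOf (p : ZMod q) = p) {V : Type*} [Zero V]
    [Finite V] (hV : Nat.card V ∣ p ^ p) (f : V → V) (hf : f^[q] = id)
    (hx : ∀ x, f x = x ↔ x = 0) : Nat.card V = 1 ∨ Nat.card V = p ^ p :=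
  eq_one_or_eq_pow_of_modEq_one hord hV (card_modEq_one_of_unique_fixed f hf 0 hx)

/-- A nontrivial `q`-th root of unity generates the field of order `p ^ p` as a ring. -/
theorem closure_singleton_eq_top (hord : orderOf (p : ZMod q) = p) {ζ : GaloisField p p}
    (hζ : ζ ^ q = 1) (hζ1 : ζ ≠ 1) : Subring.closure {ζ} = ⊤ := by
  have hfin : Finite (GaloisField p p) := inferInstance
  set S := Subring.closure {ζ}
  have hS : ζ ∈ S := Subring.subset_closure rfl
  have hcard : Nat.card S ∣ p ^ p := by
    rw [← natCard_galoisField_self p]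
    exact AddSubgroup.card_addSubgroup_dvd_card S.toAddSubgroup
  have hit : ∀ n : ℕ, ∀ x : S, ((((⟨ζ, hS⟩ : S) * ·)^[n] x : S) : GaloisField p p) = ζ ^ n * x := by
    intro n x
    rw [mul_left_iterate]
    rfl
  have h := card_eq_of_iterate_eq_id hord hcard (fun x : S => ⟨ζ, hS⟩ * x) (by
    ext x
    rw [hit, hζ, one_mul, id]) (fun x => ⟨fun h => ?_, fun h => by rw [h, mul_zero]⟩)
  · rcases h with h | h
    · exfalso
      have := (Nat.card_eq_one_iff_unique.1 h).1
      have h2 := congrArg Subtype.val (Subsingleton.elim (0 : S) 1)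
      simp at h2
    · rw [← natCard_galoisField_self p] at h
      have h3 : S.toAddSubgroup = ⊤ := (AddSubgroup.card_eq_iff_eq_top _).1 h
      rw [eq_top_iff]
      intro x _
      have : x ∈ S.toAddSubgroup := h3 ▸ AddSubgroup.mem_top x
      exact this
  · have h := congrArg Subtype.val h
    change ζ * (x : GaloisField p p) = x at h
    by_contra hx
    have hx' : (x : GaloisField p p) ≠ 0 := fun h0 => hx (Subtype.ext h0)
    exact hζ1 ((mul_eq_right₀ hx').1 h)

end Field

/-! ### Lines over the field of order `p ^ p` -/

section Line

variable {p q : ℕ} [Fact p.Prime] [Fact q.Prime]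

/-- An irreducible automorphism of order `q` of an abelian group of order `p ^ p` is the
multiplication by a `q`-th root of unity for some structure of line over the field of order `p ^ p`:
the subring generated by the automorphism is a finite domain, and by counting it has `p ^ p`
elements. -/
theorem exists_module_galoisField (hord : orderOf (p : ZMod q) = p) {V : Type*} [AddCommGroup V]
    (hV : Nat.card V = p ^ p) (T : AddMonoid.End V) (hT : T ^ q = 1) (hT1 : T ≠ 1)
    (hirr : ∀ W : AddSubgroup V, (∀ x ∈ W, T x ∈ W) → W = ⊥ ∨ W = ⊤) :
    ∃ (_ : Module (GaloisField p p) V) (ζ : GaloisField p p),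
      ζ ^ q = 1 ∧ ζ ≠ 1 ∧ ∀ v : V, ζ • v = T v := by
  have hp := (Fact.out : p.Prime)
  have hcard : 1 < Nat.card V := hV ▸ Nat.one_lt_pow hp.ne_zero hp.one_lt
  have hfin : Finite V := Nat.finite_of_card_ne_zero (by omega)
  have hnt : Nontrivial V := Finite.one_lt_card_iff_nontrivial.1 hcard
  have hfinE : Finite (AddMonoid.End V) :=
    Finite.of_injective (fun f : AddMonoid.End V => (f : V → V)) DFunLike.coe_injective
  obtain ⟨v₀, hv₀⟩ := exists_ne (0 : V)
  let S : Subring (AddMonoid.End V) := Subring.closure {T}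
  have hcomm : IsMulCommutative S := Subring.isMulCommutative_closure (by
    rintro a rfl b rfl
    rfl)
  let : CommRing S := { (inferInstance : Ring S) with mul_comm := fun a b => hcomm.is_comm.comm a b }
  have hTS : T ∈ S := Subring.subset_closure rfl
  have hinj : ∀ s : S, s ≠ 0 → ∀ v : V, (s : AddMonoid.End V) v = 0 → v = 0 := by
    intro s hs v hv
    let W : AddSubgroup V :=
      { carrier := {x | (s : AddMonoid.End V) x = 0}
        zero_mem' := map_zero _
        add_mem' := fun {a b} ha hb =>
          (map_add _ a b).trans ((congrArg₂ (· + ·) ha hb).trans (add_zero 0))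
        neg_mem' := fun {a} ha => (map_neg _ a).trans ((congrArg (- ·) ha).trans neg_zero) }
    rcases hirr W (fun x hx => by
      have h1 : s * ⟨T, hTS⟩ = ⟨T, hTS⟩ * s := mul_comm _ _
      have h2 := DFunLike.congr_fun (congrArg Subtype.val h1) x
      change (s : AddMonoid.End V) (T x) = T ((s : AddMonoid.End V) x) at h2
      change (s : AddMonoid.End V) (T x) = 0
      change (s : AddMonoid.End V) x = 0 at hx
      rw [h2, hx, map_zero]) with h | h
    · have : v ∈ W := hv
      rwa [h, AddSubgroup.mem_bot] at this
    · exfalso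
      refine hs (Subtype.ext ?_)
      ext x
      have : x ∈ W := h ▸ AddSubgroup.mem_top x
      exact this
  have hdom : NoZeroDivisors S := ⟨fun {a b} hab => by
    by_contra! hne
    refine hv₀ (hinj b hne.2 v₀ (hinj a hne.1 _ ?_))
    exact DFunLike.congr_fun (congrArg Subtype.val hab) v₀⟩
  have hntS : Nontrivial S := ⟨0, 1, fun h =>
    hv₀ (DFunLike.congr_fun (congrArg Subtype.val h) v₀).symm⟩
  have hdom' : IsDomain S := NoZeroDivisors.to_isDomain S
  let ev : S →+ V := (AddMonoidHom.eval v₀).comp S.subtype.toAddMonoidHom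
  have hev : Function.Injective ev := by
    rw [injective_iff_map_eq_zero]
    intro s hs
    by_contra h
    exact hv₀ (hinj s h v₀ hs)
  have hSd : Nat.card S ∣ p ^ p := hV ▸ AddSubgroup.card_dvd_of_injective ev hev
  have hit : ∀ n : ℕ, ∀ x : S, ((((⟨T, hTS⟩ : S) * ·)^[n] x : S) : AddMonoid.End V) = T ^ n * x := by
    intro n x
    rw [mul_left_iterate]
    rfl
  have hS : Nat.card S = p ^ p := by
    refine (card_eq_of_iterate_eq_id hord hSd (fun x : S => ⟨T, hTS⟩ * x) (by
      ext1 x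
      refine Subtype.ext ?_
      rw [hit, hT, one_mul, id]) (fun x => ⟨fun h => ?_, fun h => by rw [h, mul_zero]⟩)).resolve_left
      (Finite.one_lt_card_iff_nontrivial.2 hntS).ne'
    by_contra hx
    exact hT1 (congrArg Subtype.val ((mul_eq_right₀ hx).1 h))
  classical
  let := Fintype.ofFinite S
  let := Fintype.ofFinite (GaloisField p p)
  let : Field S := Fintype.fieldOfDomain S
  let e : S ≃+* GaloisField p p := FiniteField.ringEquivOfCardEq (by
    rw [← Nat.card_eq_fintype_card, ← Nat.card_eq_fintype_card, hS, natCard_galoisField_self])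
  let ρ : GaloisField p p →+* AddMonoid.End V := S.subtype.comp e.symm.toRingHom
  refine ⟨Module.compHom V ρ, e ⟨T, hTS⟩, ?_, ?_, fun v => ?_⟩
  · rw [← map_pow]
    have : (⟨T, hTS⟩ : S) ^ q = 1 := Subtype.ext hT
    rw [this, map_one]
  · intro h
    rw [← map_one e] at h
    exact hT1 (congrArg Subtype.val (e.injective h))
  · change ρ (e ⟨T, hTS⟩) v = T v
    have : ρ (e ⟨T, hTS⟩) = T := congrArg Subtype.val (e.symm_apply_apply ⟨T, hTS⟩)
    rw [this]

/-- An additive surjection that twists multiplication by one nontrivial `q`-th root of unity is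
semilinear with respect to a power of the Frobenius automorphism. -/
theorem exists_frobPow_smul (hord : orderOf (p : ZMod q) = p) {V : Type*} [AddCommGroup V]
    [Module (GaloisField p p) V] [Nontrivial V] {g : V →+ V} (hg : Function.Surjective g)
    {ζ : GaloisField p p} (hζ : ζ ^ q = 1) (hζ1 : ζ ≠ 1) (b : GaloisField p p)
    (hb : ∀ v, g (ζ • v) = b • g v) :
    ∃ t : ZMod p, ∀ (a : GaloisField p p) (v : V), g (a • v) = frobPow t a • g v := by
  let S : Subring (GaloisField p p) :=
    { carrier := {a | ∃ a' : GaloisField p p, ∀ v, g (a • v) = a' • g v}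
      mul_mem' := by
        rintro a b ⟨a', ha⟩ ⟨b', hb⟩
        exact ⟨a' * b', fun v => by rw [mul_smul, ha, hb, mul_smul]⟩
      one_mem' := ⟨1, fun v => by rw [one_smul, one_smul]⟩
      add_mem' := by
        rintro a b ⟨a', ha⟩ ⟨b', hb⟩
        exact ⟨a' + b', fun v => by rw [add_smul, map_add, ha, hb, add_smul]⟩
      zero_mem' := ⟨0, fun v => by rw [zero_smul, zero_smul, map_zero]⟩
      neg_mem' := by
        rintro a ⟨a', ha⟩
        exact ⟨-a', fun v => by rw [neg_smul, map_neg, ha, neg_smul]⟩ }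
  have hS : S = ⊤ := by
    rw [eq_top_iff, ← closure_singleton_eq_top hord hζ hζ1, Subring.closure_le]
    rintro _ rfl
    exact ⟨b, hb⟩
  have h : ∀ a : GaloisField p p, ∃ a' : GaloisField p p, ∀ v, g (a • v) = a' • g v := fun a => by
    have : a ∈ S := hS ▸ Subring.mem_top a
    exact this
  choose τ hτ using h
  have huniq : ∀ a b : GaloisField p p, (∀ v, a • g v = b • g v) → a = b := by
    intro a b hab
    obtain ⟨w, hw⟩ := exists_ne (0 : V)
    obtain ⟨v, rfl⟩ := hg w
    exact smul_left_injective _ hw (hab v)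
  let τ' : GaloisField p p →+* GaloisField p p :=
    { toFun := τ
      map_one' := huniq _ _ fun v => by rw [← hτ, one_smul, one_smul]
      map_mul' := fun a b => huniq _ _ fun v => by rw [← hτ, mul_smul, hτ, hτ, mul_smul]
      map_zero' := huniq _ _ fun v => by rw [← hτ, zero_smul, zero_smul, map_zero]
      map_add' := fun a b => huniq _ _ fun v => by
        rw [← hτ, add_smul, map_add, hτ, hτ, add_smul] }
  obtain ⟨t, ht⟩ := exists_frobPow_eq τ'
  exact ⟨t, fun a v => by rw [hτ, ← ht]; rfl⟩

end Line

section Cocycle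

variable {p : ℕ} [Fact p.Prime]

/-- A function `f` to `ZMod p` such that `x ↦ (x, σ ^ f x)` parametrizes a subgroup of the
semidirect product of the field of order `p ^ p` by its automorphism group is invariant under the
Frobenius automorphism `σ`. Indeed `σ` permutes the `p` fibres of `f`, it fixes the fibre of `0`,
and a permutation of order `p` of a set with `p` elements that has a fixed point is trivial. -/
theorem apply_frobPow_of_cocycle {f : GaloisField p p → ZMod p}
    (hf : ∀ x y, f (x + frobPow (f x) y) = f x + f y) (hne : ∃ x, f x ≠ 0) (t : ZMod p)
    (x : GaloisField p p) : f (frobPow t x) = f x := by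
  have h0 : f 0 = 0 := by
    have := hf 0 0
    rw [map_zero, add_zero] at this
    exact left_eq_add.1 this
  -- the image of `f` is a nonzero subgroup
  have hsurj : Function.Surjective f := by
    obtain ⟨x, hx⟩ := hne
    have hmul : ∀ n : ℕ, ∃ y, f y = n • f x := by
      intro n
      induction n with
      | zero => exact ⟨0, by rw [h0, zero_smul]⟩
      | succ n ih =>
        obtain ⟨y, hy⟩ := ih
        exact ⟨y + frobPow (f y) x, by rw [hf, hy, succ_nsmul]⟩
    intro s
    obtain ⟨y, hy⟩ := hmul (s * (f x)⁻¹).val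
    refine ⟨y, ?_⟩
    rw [hy, nsmul_eq_mul, ZMod.natCast_zmod_val, mul_assoc, inv_mul_cancel₀ hx, mul_one]
  -- the fibre of `0` is invariant: conjugate by an element `x` with `f x = t`
  have hker : ∀ w, f w = 0 → ∀ t, f (frobPow t w) = 0 := by
    intro w hw t
    obtain ⟨x, rfl⟩ := hsurj t
    have h1 := hf x w
    rw [hw, add_zero] at h1
    have h2 := hf (x + frobPow (f x) w) (-frobPow (-f x) x)
    rw [h1, map_neg, frobPow_apply_neg, add_neg_cancel_comm] at h2
    have h3 := hf x (-frobPow (-f x) x)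
    rw [map_neg, frobPow_apply_neg, add_neg_cancel, h0] at h3
    rw [h2, ← h3]
  have hadd : ∀ w y, f y = 0 → f (w + y) = f w := by
    intro w y hy
    have h1 := hf w (frobPow (-f w) y)
    rwa [frobPow_apply_neg, hker y hy, add_zero] at h1
  have hsub : ∀ w w', f w = f w' → f (w' - w) = 0 := by
    intro w w' h
    have h1 := hf w (frobPow (-f w) (w' - w))
    rw [frobPow_apply_neg, add_sub_cancel, ← h, left_eq_add] at h1
    have := hker _ h1 (f w)
    rwa [frobPow_apply_neg] at this
  have hfib : ∀ w w', f w = f w' → ∀ t, f (frobPow t w) = f (frobPow t w') := by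
    intro w w' h t
    have h1 := hadd (frobPow t w) (frobPow t (w' - w)) (hker _ (hsub w w' h) t)
    rw [← map_add, add_sub_cancel] at h1
    exact h1.symm
  -- the permutation of the fibres induced by the Frobenius automorphism
  choose r hr using hsurj
  let g : ZMod p → ZMod p := fun s => f (frobPow 1 (r s))
  have hg : ∀ x, g (f x) = f (frobPow 1 x) := fun x => hfib _ _ (hr _) 1
  have hgit : ∀ (n : ℕ) x, g^[n] (f x) = f (frobPow (n : ZMod p) x) := by
    intro n
    induction n with
    | zero => intro x; rw [Nat.cast_zero, frobPow_zero_apply]; rfl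
    | succ n ih =>
      intro x
      rw [Function.iterate_succ_apply', ih, hg, Nat.cast_succ, add_comm, frobPow_add_apply]
  have hgp : g^[p] = id := by
    ext1 s
    have h1 := hgit p (r s)
    rwa [hr, CharP.cast_eq_zero, frobPow_zero_apply, hr] at h1
  have h1 := card_modEq_card_fixed (q := p) g hgp
  have hgid : ∀ s, g s = s := by
    rw [Nat.card_zmod] at h1
    have h2 : p ∣ Nat.card {s // g s = s} := by
      rw [← Nat.modEq_zero_iff_dvd]
      exact h1.symm.trans (by simp [Nat.ModEq])
    have : Nonempty {s // g s = s} := ⟨⟨f 0, by rw [hg, map_zero]⟩⟩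
    have h3 := Nat.le_of_dvd Nat.card_pos h2
    have h4 : {s | g s = s} = Set.univ := by
      refine Set.eq_of_subset_of_ncard_le (Set.subset_univ _) ?_
      rw [Set.ncard_univ, Nat.card_zmod]
      exact h3
    intro s
    have : s ∈ {s | g s = s} := h4 ▸ Set.mem_univ s
    exact this
  have h5 := hgit t.val x
  rw [ZMod.natCast_zmod_val] at h5
  rw [← h5]
  exact Function.iterate_fixed (hgid _) _

/-- By `apply_frobPow_of_cocycle` the function `f` is linear and Galois-invariant; the trace form
is nondegenerate, so `f` is a multiple of the trace. -/
theorem exists_eq_trace_of_cocycle {f : GaloisField p p → ZMod p}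
    (hf : ∀ x y, f (x + frobPow (f x) y) = f x + f y) (hne : ∃ x, f x ≠ 0) :
    ∃ c : ZMod p, c ≠ 0 ∧ ∀ x,
      f x = Algebra.trace (ZMod p) (GaloisField p p) (algebraMap _ _ c * x) := by
  have hinv := apply_frobPow_of_cocycle hf hne
  have hadd : ∀ x y, f (x + y) = f x + f y := by
    intro x y
    have h1 := hf x (frobPow (-f x) y)
    rwa [frobPow_apply_neg, hinv] at h1
  let fl : GaloisField p p →ₗ[ZMod p] ZMod p :=
    AddMonoidHom.toZModLinearMap p (AddMonoidHom.mk' f hadd)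
  have hnd := traceForm_nondegenerate (ZMod p) (GaloisField p p)
  let b := (LinearMap.BilinForm.toDual _ hnd).symm fl
  have hb : ∀ x, f x = Algebra.trace (ZMod p) (GaloisField p p) (b * x) := by
    intro x
    have h1 := LinearMap.BilinForm.apply_toDual_symm_apply (hB := hnd) (f := fl) (v := x)
    exact h1.symm
  have hb1 : frobPow 1 b = b := by
    rw [← sub_eq_zero]
    refine hnd.1 _ fun y => ?_
    rw [Algebra.traceForm_apply, sub_mul, map_sub, sub_eq_zero, ← hb]
    have h2 := hb (frobPow (-1) y)
    rw [hinv] at h2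
    rw [h2, ← trace_frobPow 1 (b * _), map_mul (frobPow 1), frobPow_apply_neg]
  obtain ⟨c, hc⟩ := exists_algebraMap_eq hb1
  refine ⟨c, ?_, fun x => by rw [hc, hb]⟩
  rintro rfl
  obtain ⟨x, hx⟩ := hne
  apply hx
  rw [hb, ← hc, map_zero, zero_mul, map_zero]

end Cocycle

/-! ### Roots of unity in the field of order `p ^ p` -/

section Exponent

variable {p q : ℕ} [Fact p.Prime] [Fact q.Prime] [hord : Fact (orderOf (p : ZMod q) = p)]

/-- The effect of `frobPow t` on exponents of `q`-th roots of unity: multiplication by `p ^ t`. The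
exponent `t` may be taken in `ZMod p` because `p` has order `p` modulo `q`. -/
def frobExp (q : ℕ) (t : ZMod p) : ZMod q := (p : ZMod q) ^ t.val

theorem frobExp_natCast (n : ℕ) : frobExp q (n : ZMod p) = (p : ZMod q) ^ n := by
  rw [frobExp, ZMod.val_natCast]
  conv_rhs => rw [← pow_mod_orderOf, hord.out]

theorem frobExp_zero : frobExp q (0 : ZMod p) = 1 := by
  rw [← Nat.cast_zero, frobExp_natCast, pow_zero]

theorem frobExp_add (s t : ZMod p) : frobExp q (s + t) = frobExp q s * frobExp q t := by
  obtain ⟨m, rfl⟩ := ZMod.natCast_zmod_surjective s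
  obtain ⟨n, rfl⟩ := ZMod.natCast_zmod_surjective t
  rw [← Nat.cast_add, frobExp_natCast, frobExp_natCast, frobExp_natCast, pow_add]

theorem frobExp_injective : Function.Injective (frobExp (p := p) q) := by
  intro s t h
  refine ZMod.val_injective p (pow_injOn_Iio_orderOf ?_ ?_ h)
  · rw [hord.out]; exact ZMod.val_lt s
  · rw [hord.out]; exact ZMod.val_lt t

theorem exists_rootOfUnity (p q : ℕ) [Fact p.Prime] [Fact q.Prime]
    [hord : Fact (orderOf (p : ZMod q) = p)] : ∃ ζ : GaloisField p p, ζ ^ q = 1 ∧ ζ ≠ 1 := by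
  have hfin : Finite (GaloisField p p) := inferInstance
  classical
  have := Fintype.ofFinite (GaloisField p p)
  have hp := (Fact.out : p.Prime)
  have h1 : q ∣ Nat.card (GaloisField p p)ˣ := by
    rw [Nat.card_eq_fintype_card, Fintype.card_units, ← Nat.card_eq_fintype_card,
      natCard_galoisField_self]
    exact (Nat.modEq_iff_dvd' (Nat.one_lt_pow hp.ne_zero hp.one_lt).le).1
      (pow_modEq_one hord.out).symm
  obtain ⟨u, hu⟩ := exists_prime_orderOf_dvd_card' q h1
  refine ⟨u, ?_, fun h => ?_⟩
  · rw [← Units.val_pow_eq_pow_val, ← hu, pow_orderOf_eq_one, Units.val_one]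
  · rw [Units.val_eq_one.1 h, orderOf_one] at hu
    exact (Fact.out : q.Prime).ne_one hu.symm

/-- A faithful character of `ZMod q` with values in the field of order `p ^ p`. -/
noncomputable def rootChar (p q : ℕ) [Fact p.Prime] [Fact q.Prime]
    [Fact (orderOf (p : ZMod q) = p)] : AddChar (ZMod q) (GaloisField p p) :=
  AddChar.zmodChar q (exists_rootOfUnity p q).choose_spec.1

local notation "χ" => rootChar p q

theorem rootChar_pow (k : ZMod q) : χ k ^ q = 1 := by
  rw [← AddChar.map_nsmul_eq_pow, nsmul_eq_mul, CharP.cast_eq_zero, zero_mul,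
    AddChar.map_zero_eq_one]

theorem rootChar_eq_one_iff {k : ZMod q} : χ k = 1 ↔ k = 0 := by
  refine ⟨fun h => ?_, fun h => by rw [h, AddChar.map_zero_eq_one]⟩
  by_contra hk
  refine (exists_rootOfUnity p q).choose_spec.2 ?_
  have h1 : χ 1 = (exists_rootOfUnity p q).choose := by
    rw [rootChar, AddChar.zmodChar_apply, ZMod.val_one, pow_one]
  rw [← h1, ← inv_mul_cancel₀ hk, ← ZMod.natCast_zmod_val k⁻¹, ← nsmul_eq_mul,
    AddChar.map_nsmul_eq_pow, h, one_pow]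

theorem rootChar_injective : Function.Injective χ := by
  intro k l h
  rw [← sub_eq_zero, ← rootChar_eq_one_iff (p := p), AddChar.map_sub_eq_div, h, div_self]
  exact fun h0 => zero_ne_one ((zero_pow (Fact.out : q.Prime).ne_zero).symm.trans
    (h0 ▸ rootChar_pow l))

theorem rootChar_neg_mul (k : ZMod q) : χ (-k) * χ k = 1 := by
  rw [← AddChar.map_add_eq_mul, neg_add_cancel, AddChar.map_zero_eq_one]

theorem frobPow_rootChar (t : ZMod p) (k : ZMod q) :
    frobPow t (χ k) = χ (frobExp q t * k) := by
  rw [frobPow_apply, ← AddChar.map_nsmul_eq_pow, nsmul_eq_mul, frobExp]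
  push_cast
  rfl

theorem rootChar_one_ne_one : χ 1 ≠ 1 := fun h => one_ne_zero (rootChar_eq_one_iff.1 h)

/-- Every `q`-th root of unity is a value of the character. -/
theorem exists_rootChar_eq {ζ : GaloisField p p} (hζ : ζ ^ q = 1) : ∃ k, χ k = ζ := by
  have hprim : IsPrimitiveRoot (χ 1) q := by
    have := IsPrimitiveRoot.orderOf (χ 1)
    rwa [orderOf_eq_prime (rootChar_pow 1) rootChar_one_ne_one] at this
  obtain ⟨i, -, hi⟩ := hprim.eq_pow_of_pow_eq_one hζ
  exact ⟨i, by rw [← hi, ← AddChar.map_nsmul_eq_pow, nsmul_eq_mul, mul_one]⟩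

end Exponent

/-! ### The model -/

/-- The trace from the field of order `p ^ p` to its prime field. -/
noncomputable abbrev tr (p : ℕ) [Fact p.Prime] (x : GaloisField p p) : ZMod p :=
  Algebra.trace (ZMod p) (GaloisField p p) x

/-- The underlying set of the model: the field of order `p ^ p` times the `q`-th roots of unity in
it, the latter given by their exponents with respect to `rootChar p q`. -/
@[ext]
structure TraceBrace (p q : ℕ) [Fact p.Prime] where
  /-- the exponent of the root of unity -/
  exp : ZMod q
  /-- the field element -/
  vec : GaloisField p p

namespace TraceBrace

variable {p q : ℕ} [Fact p.Prime] [Fact q.Prime] [hord : Fact (orderOf (p : ZMod q) = p)]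

local notation "χ" => rootChar p q

/-- The addition of the semidirect product of the field by the roots of unity. -/
noncomputable instance : Add (TraceBrace p q) :=
  ⟨fun a b => ⟨a.exp + b.exp, a.vec + χ a.exp * b.vec⟩⟩

noncomputable instance : Zero (TraceBrace p q) := ⟨⟨0, 0⟩⟩

noncomputable instance : Neg (TraceBrace p q) := ⟨fun a => ⟨-a.exp, -(χ (-a.exp) * a.vec)⟩⟩

/-- The semidirect product multiplication, twisted by the Frobenius power with exponent the trace of
the field element of the left factor. -/
noncomputable instance : Mul (TraceBrace p q) :=
  ⟨fun a b => ⟨a.exp + frobExp q (tr p a.vec) * b.exp, a.vec + frobPow (tr p a.vec) b.vec⟩⟩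

noncomputable instance : One (TraceBrace p q) := ⟨⟨0, 0⟩⟩

noncomputable instance : Inv (TraceBrace p q) :=
  ⟨fun a => ⟨-(frobExp q (-tr p a.vec) * a.exp), -frobPow (-tr p a.vec) a.vec⟩⟩

@[simp] theorem exp_add (a b : TraceBrace p q) : (a + b).exp = a.exp + b.exp := rfl
@[simp] theorem vec_add (a b : TraceBrace p q) : (a + b).vec = a.vec + χ a.exp * b.vec := rfl
omit hord in
@[simp] theorem exp_zero : (0 : TraceBrace p q).exp = 0 := rfl
omit hord in
@[simp] theorem vec_zero : (0 : TraceBrace p q).vec = 0 := rfl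
@[simp] theorem exp_neg (a : TraceBrace p q) : (-a).exp = -a.exp := rfl
@[simp] theorem vec_neg (a : TraceBrace p q) : (-a).vec = -(χ (-a.exp) * a.vec) := rfl
omit hord in
@[simp] theorem exp_mul (a b : TraceBrace p q) :
    (a * b).exp = a.exp + frobExp q (tr p a.vec) * b.exp := rfl
omit hord in
@[simp] theorem vec_mul (a b : TraceBrace p q) :
    (a * b).vec = a.vec + frobPow (tr p a.vec) b.vec := rfl
omit hord in
@[simp] theorem exp_one : (1 : TraceBrace p q).exp = 0 := rfl
omit hord in
@[simp] theorem vec_one : (1 : TraceBrace p q).vec = 0 := rfl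
omit hord in
@[simp] theorem exp_inv (a : TraceBrace p q) :
    (a⁻¹).exp = -(frobExp q (-tr p a.vec) * a.exp) := rfl
omit hord in
@[simp] theorem vec_inv (a : TraceBrace p q) : (a⁻¹).vec = -frobPow (-tr p a.vec) a.vec := rfl

noncomputable instance : AddGroup (TraceBrace p q) :=
  AddGroup.ofLeftAxioms
    (fun a b c => by
      ext
      · simp [add_assoc]
      · simp [AddChar.map_add_eq_mul, mul_add, mul_assoc, add_assoc])
    (fun a => by ext <;> simp)
    (fun a => by ext <;> simp)

noncomputable instance : Group (TraceBrace p q) :=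
  Group.ofLeftAxioms
    (fun a b c => by
      ext
      · simp [trace_frobPow, frobExp_add, mul_add, mul_assoc, add_assoc]
      · simp [trace_frobPow, frobPow_add_apply, add_assoc])
    (fun a => by ext <;> simp [frobExp_zero, frobPow_zero_apply])
    (fun a => by ext <;> simp [trace_frobPow])

noncomputable instance : SkewBrace (TraceBrace p q) where
  brace_relation a b c := by
    ext
    · simp only [exp_mul, exp_add, exp_neg]
      ring
    · simp only [vec_mul, vec_add, exp_mul, exp_add, exp_neg, vec_neg, map_add, map_mul,
        frobPow_rootChar, AddChar.map_add_eq_mul]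
      linear_combination (-χ (frobExp q (tr p a.vec) * b.exp) * frobPow (tr p a.vec) c.vec) *
        (rootChar_neg_mul (p := p) (q := q) a.exp)

end TraceBrace

namespace SkewBrace

variable {B C : Type*} [SkewBrace B] [SkewBrace C]

theorem mul_eq_add_lam (a b : B) : a * b = a + lam a b := by
  rw [lam, add_neg_cancel_left]

/-! ### Opposite skew braces -/

/-- The conditions on an ideal, element by element. -/
theorem isIdeal_iff {I : AddSubgroup B} : IsIdeal I ↔
    (∀ a : B, ∀ b ∈ I, -a + a * b ∈ I) ∧ (∀ a : B, ∀ b ∈ I, a + b + -a ∈ I) ∧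
      ∀ a : B, ∀ b ∈ I, a * b * a⁻¹ ∈ I :=
  ⟨fun h => ⟨h.lam_mem, fun a b hb => h.normal_add.conj_mem b hb a,
    fun a b hb => h.normal_mul.conj_mem b hb a⟩,
   fun h => { lam_mem := h.1
              normal_add := ⟨fun b hb a => h.2.1 a b hb⟩
              normal_mul := ⟨fun b hb a => h.2.2 a b hb⟩ }⟩

/-- An additive subgroup of the opposite skew brace, viewed in the skew brace itself. -/
def unopSubgroup (I : AddSubgroup Bᵃᵒᵖ) : AddSubgroup B where
  carrier := {b | AddOpposite.op b ∈ I}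
  zero_mem' := I.zero_mem
  add_mem' ha hb := I.add_mem hb ha
  neg_mem' ha := I.neg_mem ha

theorem isIdeal_unopSubgroup {I : AddSubgroup Bᵃᵒᵖ} (h : IsIdeal I) :
    IsIdeal (unopSubgroup I) := by
  rw [isIdeal_iff] at h ⊢
  have hconj : ∀ a : B, ∀ b ∈ unopSubgroup I, a + b + -a ∈ unopSubgroup I := by
    intro a b hb
    have h1 := h.2.1 (AddOpposite.op (-a)) _ hb
    change AddOpposite.op (-(-a) + (b + -a)) ∈ I at h1
    rw [neg_neg, ← add_assoc] at h1
    exact h1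
  refine ⟨fun a b hb => ?_, hconj, fun a b hb => h.2.2 (AddOpposite.op a) _ hb⟩
  have h1 : a * b + -a ∈ unopSubgroup I := h.1 (AddOpposite.op a) _ hb
  have h2 := hconj (-a) _ h1
  rwa [neg_neg, add_assoc, neg_add_cancel_right] at h2

theorem IsSimple.addOpposite (h : IsSimple B) : IsSimple Bᵃᵒᵖ where
  nontrivial := by
    have := h.nontrivial
    exact AddOpposite.opEquiv.symm.nontrivial
  eq_bot_or_eq_top I hI := by
    rcases h.eq_bot_or_eq_top _ (isIdeal_unopSubgroup hI) with h1 | h1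
    · left
      rw [eq_bot_iff]
      intro x hx
      have h2 : AddOpposite.unop x ∈ unopSubgroup I := hx
      rw [h1, AddSubgroup.mem_bot] at h2
      exact AddOpposite.unop_injective h2
    · right
      rw [eq_top_iff]
      intro x _
      have h2 : AddOpposite.unop x ∈ unopSubgroup I := h1 ▸ AddSubgroup.mem_top _
      exact h2

/-- Taking opposites is functorial. -/
def opIso (e : B ≃+* C) : Bᵃᵒᵖ ≃+* Cᵃᵒᵖ where
  toFun b := AddOpposite.op (e b.unop)
  invFun c := AddOpposite.op (e.symm c.unop)
  left_inv b := by simp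
  right_inv c := by simp
  map_mul' a b := by simp
  map_add' a b := by simp

/-- A skew brace is the opposite of its opposite. -/
def opOpIso : B ≃+* Bᵃᵒᵖᵃᵒᵖ where
  toFun b := AddOpposite.op (AddOpposite.op b)
  invFun b := b.unop.unop
  left_inv _ := rfl
  right_inv _ := rfl
  map_mul' _ _ := rfl
  map_add' _ _ := rfl

/-- Isomorphic skew braces have isomorphic automorphism groups. -/
def autCongr (e : B ≃+* C) : RingAut B ≃* RingAut C where
  toFun f := (e.symm.trans f).trans e
  invFun f := (e.trans f).trans e.symm
  left_inv f := by
    apply RingEquiv.ext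
    intro x
    simp
  right_inv f := by
    apply RingEquiv.ext
    intro x
    simp
  map_mul' f g := by
    apply RingEquiv.ext
    intro x
    simp [RingAut.mul_apply]

/-- A skew brace and its opposite have the same automorphisms. -/
def autOpposite : RingAut Bᵃᵒᵖ ≃* RingAut B where
  toFun f :=
    { toFun b := (f (AddOpposite.op b)).unop
      invFun b := (f.symm (AddOpposite.op b)).unop
      left_inv b := by simp
      right_inv b := by simp
      map_mul' a b := by simp
      map_add' a b := by simp }
  invFun f := opIso f
  left_inv f := rfl
  right_inv f := rfl
  map_mul' f g := rfl

end SkewBrace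

/-! ### Properties of the model -/

namespace TraceBrace

variable {p q : ℕ} [Fact p.Prime] [Fact q.Prime] [hord : Fact (orderOf (p : ZMod q) = p)]

local notation "χ" => rootChar p q

omit hord [Fact q.Prime] in
theorem natCard_traceBrace : Nat.card (TraceBrace p q) = p ^ p * q := by
  have e : TraceBrace p q ≃ ZMod q × GaloisField p p :=
    ⟨fun a => (a.exp, a.vec), fun a => ⟨a.1, a.2⟩, fun _ => rfl, fun _ => rfl⟩
  rw [Nat.card_congr e, Nat.card_prod, Nat.card_zmod, natCard_galoisField_self, mul_comm]

theorem eq_add (a : TraceBrace p q) : a = ⟨0, a.vec⟩ + ⟨a.exp, 0⟩ := by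
  ext <;> simp

variable (p q) in
theorem exists_trace_eq_one : ∃ x : GaloisField p p, tr p x = 1 := trace_surjective_galoisField 1

theorem frobExp_one_ne_one : frobExp q (1 : ZMod p) ≠ 1 := fun h =>
  one_ne_zero (frobExp_injective (q := q) (h.trans frobExp_zero.symm))

/-- The model is simple: a nonzero ideal contains a nonzero field element, then the whole field
because the roots of unity generate it, then everything because the field is not normal for the
multiplication. -/
theorem isSimple : IsSimple (TraceBrace p q) where
  nontrivial := ⟨⟨0, ⟨0, 1⟩, fun h => zero_ne_one (congrArg vec h)⟩⟩
  eq_bot_or_eq_top I hI := by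
    rw [isIdeal_iff] at hI
    obtain ⟨hlam, hadd, hmul⟩ := hI
    by_cases hbot : I = ⊥
    · exact .inl hbot
    right
    obtain ⟨a, ha, ha0⟩ := (AddSubgroup.bot_or_exists_ne_zero I).resolve_left hbot
    -- a nonzero field element
    have h1 : ∃ y : GaloisField p p, y ≠ 0 ∧ (⟨0, y⟩ : TraceBrace p q) ∈ I := by
      by_cases hv : a.vec = 0
      · have he : a.exp ≠ 0 := fun h => ha0 (TraceBrace.ext h hv)
        refine ⟨1 - χ a.exp, ?_, ?_⟩
        · rw [sub_ne_zero]
          exact fun h => he (rootChar_eq_one_iff.1 h.symm)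
        · have h2 := I.add_mem (hadd ⟨0, 1⟩ a ha) (I.neg_mem ha)
          convert h2 using 1
          ext <;> simp [hv, sub_eq_add_neg]
      · refine ⟨χ 1 * a.vec - a.vec, ?_, ?_⟩
        · rw [sub_ne_zero]
          exact fun h => rootChar_one_ne_one ((mul_eq_right₀ hv).1 h)
        · have h2 := I.add_mem (hlam ⟨-1, 0⟩ a ha) (I.neg_mem ha)
          convert h2 using 1
          ext
          · simp [frobExp_zero]
          · have h3 : χ a.exp * χ (-a.exp) = 1 := by rw [mul_comm, rootChar_neg_mul]
            simp [frobExp_zero, frobPow_zero_apply, ← mul_assoc, h3, sub_eq_add_neg]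
    obtain ⟨y, hy0, hy⟩ := h1
    -- all field elements
    let J : AddSubgroup (GaloisField p p) :=
      { carrier := {x | (⟨0, x⟩ : TraceBrace p q) ∈ I}
        zero_mem' := I.zero_mem
        add_mem' := fun {x y} hx hy => by
          have := I.add_mem hx hy
          change (⟨0, x + y⟩ : TraceBrace p q) ∈ I
          convert this using 1
          ext <;> simp
        neg_mem' := fun {x} hx => by
          have := I.neg_mem hx
          change (⟨0, -x⟩ : TraceBrace p q) ∈ I
          convert this using 1
          ext <;> simp }
    have hJ : ∀ x ∈ J, χ 1 * x ∈ J := by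
      intro x hx
      have h2 := hlam ⟨-1, 0⟩ _ hx
      change _ ∈ I
      convert h2 using 1
      ext
      · simp
      · simp [frobPow_zero_apply]
    let S : Subring (GaloisField p p) :=
      { carrier := {s | ∀ x ∈ J, s * x ∈ J}
        mul_mem' := fun {a b} ha hb x hx => by
          rw [mul_assoc]
          exact ha _ (hb _ hx)
        one_mem' := fun x hx => by rwa [one_mul]
        add_mem' := fun {a b} ha hb x hx => by
          rw [add_mul]
          exact J.add_mem (ha _ hx) (hb _ hx)
        zero_mem' := fun x hx => by
          rw [zero_mul]
          exact J.zero_mem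
        neg_mem' := fun {a} ha x hx => by
          rw [neg_mul]
          exact J.neg_mem (ha _ hx) }
    have hS : S = ⊤ := by
      rw [eq_top_iff, ← closure_singleton_eq_top hord.out (rootChar_pow 1) rootChar_one_ne_one,
        Subring.closure_le]
      rintro _ rfl
      exact hJ
    have hvec : ∀ x : GaloisField p p, (⟨0, x⟩ : TraceBrace p q) ∈ I := by
      intro x
      have h2 : x * y⁻¹ ∈ S := hS ▸ Subring.mem_top _
      have h3 : x * y⁻¹ * y ∈ J := h2 y hy
      rwa [inv_mul_cancel_right₀ hy0] at h3
    -- a root of unity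
    obtain ⟨x, hx⟩ := exists_trace_eq_one p
    have h4 : (⟨1 - frobExp q (1 : ZMod p), 0⟩ : TraceBrace p q) ∈ I := by
      have h5 := hmul ⟨1, 0⟩ _ (hvec x)
      have h6 := I.add_mem (hvec (-x)) h5
      convert h6 using 1
      ext
      · simp [frobExp_zero, frobPow_zero_apply, hx, sub_eq_add_neg]
      · simp [frobPow_zero_apply]
    rw [eq_top_iff]
    intro b _
    rw [eq_add b]
    refine I.add_mem (hvec _) ?_
    let f : ZMod q →+ TraceBrace p q :=
      { toFun := fun k => ⟨k, 0⟩
        map_zero' := rfl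
        map_add' := fun k l => by ext <;> simp }
    have h7 : 1 - frobExp q (1 : ZMod p) ≠ 0 := sub_ne_zero.2 frobExp_one_ne_one.symm
    have h8 : f b.exp = (b.exp * (1 - frobExp q (1 : ZMod p))⁻¹).val •
        f (1 - frobExp q (1 : ZMod p)) := by
      rw [← map_nsmul, nsmul_eq_mul, ZMod.natCast_zmod_val, inv_mul_cancel_right₀ h7]
    change f b.exp ∈ I
    rw [h8]
    exact I.nsmul_mem h4 _

/-- In the model, left multiplication by an element of additive order `q` can coincide with right
addition; in the opposite model it cannot. -/
theorem isEmpty_iso_opposite : IsEmpty (TraceBrace p q ≃+* (TraceBrace p q)ᵃᵒᵖ) := by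
  refine ⟨fun e => ?_⟩
  let a : TraceBrace p q := ⟨1, 0⟩
  have ha : ∀ b, a * b = b + a := by
    intro b
    ext
    · simp [a, frobExp_zero, add_comm]
    · simp [a, frobPow_zero_apply]
  let c : TraceBrace p q := (e a).unop
  have hc : ∀ b, c * b = c + b := by
    intro b
    have h1 := congrArg e (ha (e.symm (AddOpposite.op b)))
    rw [map_mul, map_add, RingEquiv.apply_symm_apply] at h1
    exact congrArg AddOpposite.unop h1
  have hc1 : c.exp = 0 := by
    have h1 := congrArg exp (hc ⟨1, 0⟩)
    have h2 := congrArg vec (hc ⟨0, 1⟩)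
    simp only [vec_mul, vec_add, map_one, mul_one, add_right_inj] at h2
    exact rootChar_eq_one_iff.1 h2.symm
  have hc2 : p • c = 0 := by
    have h1 : ∀ n : ℕ, n • c = ⟨0, n • c.vec⟩ := by
      intro n
      induction n with
      | zero => rw [zero_smul, zero_smul]; rfl
      | succ n ih => rw [succ_nsmul, ih, succ_nsmul]; ext <;> simp [hc1]
    rw [h1, nsmul_eq_mul, CharP.cast_eq_zero, zero_mul]
    rfl
  have ha2 : p • a = 0 := by
    have h1 : e (p • a) = 0 := by
      rw [map_nsmul]
      exact AddOpposite.unop_injective hc2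
    exact (map_eq_zero_iff e e.injective).1 h1
  have h1 : ∀ n : ℕ, (n • a).exp = n := by
    intro n
    induction n with
    | zero => rw [zero_smul, Nat.cast_zero]; rfl
    | succ n ih => rw [succ_nsmul, exp_add, ih, Nat.cast_succ]
  have h2 := h1 p
  rw [ha2] at h2
  exact natCast_ne_zero_of_orderOf hord.out h2.symm

end TraceBrace

/-! ### Automorphisms of the model -/

namespace TraceBrace

variable {p q : ℕ} [Fact p.Prime] [Fact q.Prime] [hord : Fact (orderOf (p : ZMod q) = p)]

local notation "χ" => rootChar p q

/-- The Frobenius automorphism with exponent `t`, acting on both components of the model. -/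
noncomputable def frobAut (t : ZMod p) : RingAut (TraceBrace p q) where
  toFun a := ⟨frobExp q t * a.exp, frobPow t a.vec⟩
  invFun a := ⟨frobExp q (-t) * a.exp, frobPow (-t) a.vec⟩
  left_inv a := by
    ext
    · simp [← mul_assoc, ← frobExp_add, frobExp_zero]
    · simp [frobPow_neg_apply]
  right_inv a := by
    ext
    · simp [← mul_assoc, ← frobExp_add, frobExp_zero]
    · simp [frobPow_apply_neg]
  map_mul' a b := by
    ext
    · simp only [exp_mul, trace_frobPow]
      ring
    · simp only [vec_mul, trace_frobPow, map_add, ← frobPow_add_apply]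
      rw [add_comm t]
  map_add' a b := by
    ext
    · simp only [exp_add]
      ring
    · simp only [vec_add, map_add, map_mul, frobPow_rootChar]

/-- Every automorphism of the model is a power of the Frobenius automorphism: it preserves the
elements of order `p` and the elements `a` with `a * b = b + a` for all `b`, so it has a component
on roots of unity and a component `g` on the field; `g` is semilinear, commutes with the Frobenius
automorphism and preserves the trace. -/
theorem exists_frobAut_eq (γ : RingAut (TraceBrace p q)) : ∃ t : ZMod p, frobAut t = γ := by
  let fstHom : TraceBrace p q →+ ZMod q :=
    { toFun := exp, map_zero' := rfl, map_add' := fun _ _ => rfl }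
  let vecHom : GaloisField p p →+ TraceBrace p q :=
    { toFun := fun x => ⟨0, x⟩
      map_zero' := rfl
      map_add' := fun x y => by ext <;> simp }
  let expHom : ZMod q →+ TraceBrace p q :=
    { toFun := fun x => ⟨x, 0⟩
      map_zero' := rfl
      map_add' := fun x y => by ext <;> simp }
  have hvec : ∀ (γ : RingAut (TraceBrace p q)) x, (γ (vecHom x)).exp = 0 := by
    intro γ x
    have h1 : p • vecHom x = 0 := by
      rw [← map_nsmul, nsmul_eq_mul, CharP.cast_eq_zero, zero_mul, map_zero]
    have h2 : p • fstHom (γ (vecHom x)) = 0 := by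
      rw [← map_nsmul, ← map_nsmul, h1, map_zero, map_zero]
    rw [nsmul_eq_mul] at h2
    exact (mul_eq_zero.1 h2).resolve_left (natCast_ne_zero_of_orderOf hord.out)
  have hexp : ∀ k, (γ (expHom k)).vec = 0 := by
    intro k
    have h1 : ∀ b, γ (expHom k) * b = b + γ (expHom k) := by
      intro b
      obtain ⟨b, rfl⟩ := γ.surjective b
      rw [← map_mul, ← map_add]
      congr 1
      ext
      · simp [expHom, frobExp_zero, add_comm]
      · simp [expHom, frobPow_zero_apply]
    have h2 := congrArg vec (h1 ⟨1, 0⟩)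
    simp only [vec_mul, vec_add, map_zero, add_zero, zero_add] at h2
    by_contra h
    exact rootChar_one_ne_one ((mul_eq_right₀ h).1 h2.symm)
  let g : GaloisField p p →+ GaloisField p p :=
    { toFun := fun x => (γ (vecHom x)).vec
      map_zero' := by rw [map_zero, map_zero]; rfl
      map_add' := fun x y => by
        rw [map_add, map_add, vec_add, hvec, AddChar.map_zero_eq_one, one_mul] }
  let h : ZMod q →+ ZMod q := (fstHom.comp (γ : TraceBrace p q ≃+ TraceBrace p q).toAddMonoidHom).comp expHom
  have hg : ∀ x, γ (vecHom x) = vecHom (g x) := fun x => TraceBrace.ext (hvec γ x) rfl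
  have hh : ∀ k, γ (expHom k) = expHom (h k) := fun k => TraceBrace.ext rfl (hexp k)
  have hgsurj : Function.Surjective g := by
    intro y
    refine ⟨(γ.symm (vecHom y)).vec, ?_⟩
    have h1 : vecHom (γ.symm (vecHom y)).vec = γ.symm (vecHom y) :=
      TraceBrace.ext (hvec γ.symm y).symm rfl
    have h2 := hg (γ.symm (vecHom y)).vec
    rw [h1, RingEquiv.apply_symm_apply] at h2
    exact (congrArg vec h2).symm
  have hγ : ∀ a, γ a = vecHom (g a.vec) + expHom (h a.exp) := by
    intro a
    rw [← hg, ← hh, ← map_add]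
    exact congrArg γ (eq_add a)
  -- compatibility with the addition
  have hsmul : ∀ k x, g (χ k • x) = χ (h k) • g x := by
    intro k x
    have h1 : expHom k + vecHom x = ⟨k, χ k * x⟩ := by ext <;> simp [expHom, vecHom]
    have h2 := congrArg γ h1
    rw [map_add, hg, hh, hγ] at h2
    have h3 := congrArg vec h2
    simp only [vec_add] at h3
    simpa [expHom, vecHom] using h3.symm
  obtain ⟨t, ht⟩ := exists_frobPow_smul hord.out hgsurj (rootChar_pow 1) rootChar_one_ne_one _
    (hsmul 1)
  have hgt : ∀ x, g x = frobPow t x * g 1 := fun x => by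
    have := ht x 1
    rwa [smul_eq_mul, mul_one, smul_eq_mul] at this
  have hg1 : g 1 ≠ 0 := by
    intro h0
    obtain ⟨x, hx⟩ := hgsurj 1
    rw [hgt, h0, mul_zero] at hx
    exact zero_ne_one hx
  have hht : ∀ k, h k = frobExp q t * k := by
    intro k
    have h1 := hsmul k 1
    rw [smul_eq_mul, mul_one, hgt, frobPow_rootChar, smul_eq_mul] at h1
    exact (rootChar_injective (mul_right_cancel₀ hg1 h1)).symm
  have hunit : ∀ t : ZMod p, frobExp q t ≠ 0 := fun t =>
    pow_ne_zero _ (natCast_ne_zero_of_orderOf hord.out)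
  -- compatibility with the multiplication
  have htr : ∀ x, tr p (g x) = tr p x := by
    intro x
    have h1 : vecHom x * expHom 1 = ⟨frobExp q (tr p x) * 1, x⟩ := by
      ext <;> simp [expHom, vecHom]
    have h2 := congrArg γ h1
    rw [map_mul, hg, hh, hγ] at h2
    have h3 := congrArg exp h2
    simp only [exp_add, exp_mul, hht] at h3
    change 0 + frobExp q (tr p (g x)) * _ = 0 + frobExp q t * _ at h3
    rw [zero_add, zero_add, mul_one, mul_one, mul_comm] at h3
    exact frobExp_injective (mul_left_cancel₀ (hunit t) h3)
  have hcomm : frobPow 1 (g 1) = g 1 := by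
    obtain ⟨x, hx⟩ := exists_trace_eq_one p
    have h1 : vecHom x * vecHom 1 = vecHom (x + frobPow (tr p x) 1) := by
      ext <;> simp [vecHom]
    have h2 := congrArg γ h1
    rw [map_mul, hg, hg, hg, map_add, map_one (frobPow _)] at h2
    have h3 := congrArg vec h2
    change g x + frobPow (tr p (g x)) (g 1) = g x + g 1 at h3
    rw [htr, hx] at h3
    exact add_left_cancel h3
  obtain ⟨c, hc⟩ := exists_algebraMap_eq hcomm
  have hc1 : c = 1 := by
    obtain ⟨x, hx⟩ := exists_trace_eq_one p
    have h1 := htr x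
    rw [hgt, ← hc, mul_comm, ← Algebra.smul_def] at h1
    unfold tr at h1
    rw [map_smul, trace_frobPow] at h1
    change c • tr p x = tr p x at h1
    rwa [hx, smul_eq_mul, mul_one] at h1
  refine ⟨t, RingEquiv.ext fun a => ?_⟩
  rw [hγ]
  ext
  · change _ = 0 + h a.exp
    rw [hht, zero_add]
    rfl
  · change _ = g a.vec + _ * 0
    rw [hgt, ← hc, hc1, map_one, mul_one, mul_zero, add_zero]
    rfl

variable (p q) in
theorem isCyclic_and_card_ringAut :
    IsCyclic (RingAut (TraceBrace p q)) ∧ Nat.card (RingAut (TraceBrace p q)) = p := by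
  let f : Multiplicative (ZMod p) →* RingAut (TraceBrace p q) :=
    MonoidHom.mk' (fun t => frobAut t.toAdd) fun s t => RingEquiv.ext fun a => by
      ext
      · change frobExp q (s.toAdd + t.toAdd) * a.exp =
          frobExp q s.toAdd * (frobExp q t.toAdd * a.exp)
        rw [frobExp_add, mul_assoc]
      · exact frobPow_add_apply _ _ _
  have hs : Function.Surjective f := fun γ => by
    obtain ⟨t, ht⟩ := exists_frobAut_eq γ
    exact ⟨Multiplicative.ofAdd t, ht⟩
  have hi : Function.Injective f := fun s t hst => by
    have h1 : frobAut (q := q) s.toAdd = frobAut t.toAdd := hst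
    have h2 := congrArg exp (DFunLike.congr_fun h1 ⟨1, 0⟩)
    change frobExp q s.toAdd * 1 = frobExp q t.toAdd * 1 at h2
    rw [mul_one, mul_one] at h2
    exact Multiplicative.toAdd.injective (frobExp_injective h2)
  refine ⟨isCyclic_of_surjective f hs, ?_⟩
  rw [← Nat.card_congr (Equiv.ofBijective f ⟨hi, hs⟩)]
  exact Nat.card_zmod p

/-! ### The two groups of the model as semidirect products -/

variable (p q) in
/-- The additive group of the model, with the field replaced by `C_p ^ p`. -/
theorem exists_additive_iso :
    ∃ φ : Multiplicative (ZMod q) →* MulAut (Multiplicative (Fin p → ZMod p)), φ ≠ 1 ∧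
      Nonempty (Multiplicative (TraceBrace p q) ≃*
        Multiplicative (Fin p → ZMod p) ⋊[φ] Multiplicative (ZMod q)) := by
  have hp := (Fact.out : p.Prime)
  let L : GaloisField p p ≃ₗ[ZMod p] (Fin p → ZMod p) :=
    LinearEquiv.ofFinrankEq _ _ (by rw [GaloisField.finrank p hp.ne_zero, Module.finrank_fin_fun])
  let act (k : ZMod q) : MulAut (Multiplicative (Fin p → ZMod p)) :=
    { toFun := fun v => .ofAdd (L (χ k * L.symm v.toAdd))
      invFun := fun v => .ofAdd (L (χ (-k) * L.symm v.toAdd))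
      left_inv := fun v => by
        simp [← mul_assoc, rootChar_neg_mul]
      right_inv := fun v => by
        simp [← mul_assoc, ← AddChar.map_add_eq_mul]
      map_mul' := fun v w => by
        simp [mul_add] }
  let φ : Multiplicative (ZMod q) →* MulAut (Multiplicative (Fin p → ZMod p)) :=
    MonoidHom.mk' (fun k => act k.toAdd) fun k l => by
      ext1 v
      change Multiplicative.ofAdd (L (χ (k.toAdd + l.toAdd) * L.symm v.toAdd)) =
        .ofAdd (L (χ k.toAdd * L.symm (L (χ l.toAdd * L.symm v.toAdd))))
      rw [LinearEquiv.symm_apply_apply, AddChar.map_add_eq_mul, mul_assoc]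
  refine ⟨φ, fun h => ?_, ⟨?_⟩⟩
  · have h1 := DFunLike.congr_fun (DFunLike.congr_fun h (Multiplicative.ofAdd 1))
      (Multiplicative.ofAdd (L 1))
    change Multiplicative.ofAdd (L (χ 1 * L.symm (L 1))) = .ofAdd (L 1) at h1
    rw [LinearEquiv.symm_apply_apply, mul_one] at h1
    exact rootChar_one_ne_one (L.injective (Multiplicative.ofAdd.injective h1))
  · exact
      { toFun := fun a => ⟨.ofAdd (L a.toAdd.vec), .ofAdd a.toAdd.exp⟩
        invFun := fun b => .ofAdd ⟨b.right.toAdd, L.symm b.left.toAdd⟩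
        left_inv := fun a => by
          apply Multiplicative.toAdd.injective
          ext <;> simp
        right_inv := fun b => by
          ext1 <;> simp
        map_mul' := fun a b => by
          ext1
          · change Multiplicative.ofAdd (L (a.toAdd.vec + χ a.toAdd.exp * b.toAdd.vec)) =
              .ofAdd (L a.toAdd.vec) *
                .ofAdd (L (χ a.toAdd.exp * L.symm (L b.toAdd.vec)))
            rw [LinearEquiv.symm_apply_apply, map_add]
            rfl
          · rfl }

/-- The Sylow `p`-subgroup of the multiplicative group of the model. -/
def vecSubgroup (p q : ℕ) [Fact p.Prime] [Fact q.Prime] [Fact (orderOf (p : ZMod q) = p)] :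
    Subgroup (TraceBrace p q) where
  carrier := {a | a.exp = 0}
  one_mem' := rfl
  mul_mem' {a b} ha hb := by
    change a.exp = 0 at ha
    change b.exp = 0 at hb
    change a.exp + _ * b.exp = 0
    rw [ha, hb, mul_zero, add_zero]
  inv_mem' {a} ha := by
    change a.exp = 0 at ha
    change -(_ * a.exp) = 0
    rw [ha, mul_zero, neg_zero]

variable (p q) in
theorem exists_multiplicative_iso :
    ∃ (P : Type) (_ : Group P) (ψ : P →* MulAut (Multiplicative (ZMod q))), Nat.card P = p ^ p ∧
      (∃ α : MulAut (Multiplicative (ZMod q)), orderOf α = p ∧ ψ.range = Subgroup.zpowers α) ∧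
      Nonempty (TraceBrace p q ≃* Multiplicative (ZMod q) ⋊[ψ] P) := by
  let act (t : ZMod p) : MulAut (Multiplicative (ZMod q)) :=
    { toFun := fun k => .ofAdd (frobExp q t * k.toAdd)
      invFun := fun k => .ofAdd (frobExp q (-t) * k.toAdd)
      left_inv := fun k => by simp [← mul_assoc, ← frobExp_add, frobExp_zero]
      right_inv := fun k => by simp [← mul_assoc, ← frobExp_add, frobExp_zero]
      map_mul' := fun k l => by simp [mul_add] }
  let actHom : Multiplicative (ZMod p) →* MulAut (Multiplicative (ZMod q)) :=
    MonoidHom.mk' (fun t => act t.toAdd) fun s t => by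
      ext1 k
      change Multiplicative.ofAdd (frobExp q (s.toAdd + t.toAdd) * k.toAdd) =
        .ofAdd (frobExp q s.toAdd * (frobExp q t.toAdd * k.toAdd))
      rw [frobExp_add, mul_assoc]
  let trHom : vecSubgroup p q →* Multiplicative (ZMod p) :=
    MonoidHom.mk' (fun a => .ofAdd (tr p a.1.vec)) fun a b => by
      change Multiplicative.ofAdd (tr p (a.1.vec + frobPow _ b.1.vec)) = .ofAdd (_ + _)
      unfold tr
      rw [map_add, trace_frobPow]
      rfl
  have htr : Function.Surjective trHom := fun t => by
    obtain ⟨x, hx⟩ := trace_surjective_galoisField (p := p) t.toAdd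
    exact ⟨⟨⟨0, x⟩, rfl⟩, congrArg Multiplicative.ofAdd hx⟩
  have hgen : Subgroup.zpowers (Multiplicative.ofAdd (1 : ZMod p)) = ⊤ := by
    rw [eq_top_iff]
    intro t _
    refine Subgroup.mem_zpowers_iff.2 ⟨(t.toAdd.val : ℤ), ?_⟩
    rw [zpow_natCast, ← ofAdd_nsmul, nsmul_eq_mul, ZMod.natCast_zmod_val, mul_one]
    rfl
  refine ⟨vecSubgroup p q, inferInstance, actHom.comp trHom, ?_,
    ⟨actHom (.ofAdd 1), orderOf_eq_prime ?_ fun h => ?_, ?_⟩, ⟨?_⟩⟩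
  · rw [← natCard_galoisField_self p]
    exact Nat.card_congr ⟨fun a => a.1.vec, fun x => ⟨⟨0, x⟩, rfl⟩,
      fun a => Subtype.ext (TraceBrace.ext a.2.symm rfl), fun _ => rfl⟩
  · rw [← map_pow, ← ofAdd_nsmul, nsmul_eq_mul, CharP.cast_eq_zero, zero_mul, ofAdd_zero, map_one]
  · have h1 := DFunLike.congr_fun h (Multiplicative.ofAdd 1)
    change Multiplicative.ofAdd (frobExp q (1 : ZMod p) * 1) = .ofAdd 1 at h1
    rw [mul_one] at h1
    exact frobExp_one_ne_one (Multiplicative.ofAdd.injective h1)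
  · rw [MonoidHom.range_comp, MonoidHom.range_eq_top.2 htr, ← hgen, MonoidHom.map_zpowers]
  · exact
      { toFun := fun a => ⟨.ofAdd a.exp, ⟨⟨0, a.vec⟩, rfl⟩⟩
        invFun := fun b => ⟨b.left.toAdd, b.right.1.vec⟩
        left_inv := fun a => rfl
        right_inv := fun b => by
          ext1
          · rfl
          · exact Subtype.ext (TraceBrace.ext b.right.2.symm rfl)
        map_mul' := fun a b => by
          ext1
          · rfl
          · refine Subtype.ext (TraceBrace.ext ?_ rfl)
            change 0 = 0 + _ * (0 : ZMod q)
            rw [mul_zero, add_zero] }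

end TraceBrace

/-! ### Left ideals and characteristic subgroups -/

namespace SkewBrace

variable {B : Type*} [SkewBrace B]

theorem lam_add (a b c : B) : lam a (b + c) = lam a b + lam a c := by
  simp only [lam, brace_relation, add_assoc]

theorem lam_zero (a : B) : lam a 0 = 0 := by
  rw [lam, mul_zero_eq, neg_add_cancel]

theorem lam_neg (a b : B) : lam a (-b) = -lam a b := by
  rw [eq_neg_iff_add_eq_zero, ← lam_add, neg_add_cancel, lam_zero]

theorem lam_one (b : B) : lam 1 b = b := by
  rw [lam, one_mul, one_eq_zero, neg_zero, zero_add]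

theorem lam_mul (a b c : B) : lam (a * b) c = lam a (lam b c) := by
  have h : lam a (lam b c) = -lam a b + lam a (b * c) := by
    rw [← lam_neg, ← lam_add]
    rfl
  rw [h]
  simp only [lam, neg_add_rev, neg_neg, mul_assoc, add_assoc, add_neg_cancel_left]

theorem lam_inv_lam (a b : B) : lam a⁻¹ (lam a b) = b := by
  rw [← lam_mul, inv_mul_cancel, lam_one]

theorem lam_lam_inv (a b : B) : lam a (lam a⁻¹ b) = b := by
  rw [← lam_mul, mul_inv_cancel, lam_one]

/-- The map `λ_a` as an automorphism of the additive group. -/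
def lamEquiv (a : B) : B ≃+ B where
  toFun := lam a
  invFun := lam a⁻¹
  left_inv := lam_inv_lam a
  right_inv := lam_lam_inv a
  map_add' := lam_add a

theorem isLeftIdeal_of_characteristic {I : AddSubgroup B}
    (h : (AddSubgroup.toSubgroup I).Characteristic) : IsLeftIdeal I where
  lam_mem a b hb := by
    have h1 := h.fixed (AddEquiv.toMultiplicative (lamEquiv a))
    have h2 : Multiplicative.ofAdd b ∈ AddSubgroup.toSubgroup I := hb
    rw [← h1] at h2
    exact h2

/-! ### The two groups of a simple skew brace of order `p ^ p * q` -/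

section Simple

variable {p q : ℕ} [Fact p.Prime] [Fact q.Prime] [hord : Fact (orderOf (p : ZMod q) = p)]

/-- Normal Hall subgroups of the same order in both groups coincide and form an ideal. -/
theorem IsSimple.not_both_normal [Finite B] (hs : IsSimple B) {N : Subgroup (Multiplicative B)}
    [N.Normal] {M : Subgroup B} [M.Normal] (hNM : Nat.card N = Nat.card M)
    (hco : (Nat.card M).Coprime M.index) (h1 : Nat.card M ≠ 1) (hi : M.index ≠ 1) : False := by
  have hci : Nat.card N * N.index = Nat.card M * M.index := by
    rw [N.card_mul_index, M.card_mul_index]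
    rfl
  have hindex : N.index = M.index := by
    rw [hNM] at hci
    exact Nat.eq_of_mul_eq_mul_left Nat.card_pos hci
  have hchar : N.Characteristic :=
    Subgroup.characteristic_of_coprime_index (by rwa [hNM, hindex])
  let I : AddSubgroup B := AddSubgroup.toSubgroup.symm N
  have hI : IsLeftIdeal I := isLeftIdeal_of_characteristic hchar
  have hIM : hI.toSubgroup = M := Subgroup.eq_of_card_eq_of_coprime_index hNM hco
  have hid : IsIdeal I :=
    { toIsLeftIdeal := hI
      normal_add := ⟨fun b hb a => (inferInstance : N.Normal).conj_mem (.ofAdd b) hb (.ofAdd a)⟩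
      normal_mul := hIM ▸ inferInstance }
  have hcI : Nat.card I = Nat.card M := hNM
  rcases hs.eq_bot_or_eq_top I hid with h | h
  · rw [h] at hcI
    exact h1 (hcI.symm.trans (by simp))
  · rw [h] at hcI
    apply hi
    rw [Subgroup.index_eq_one, ← Subgroup.card_eq_iff_eq_top, ← hcI]
    exact Nat.card_congr AddSubgroup.topEquiv.toEquiv

variable (hC : Nat.card B = p ^ p * q) (hs : IsSimple B)

include hC hs in
theorem IsSimple.not_both_card_prime {N : Subgroup (Multiplicative B)}
    (hNn : N.Normal) (hN : Nat.card N = q) {M : Subgroup B} (hMn : M.Normal)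
    (hM : Nat.card M = q) : False := by
  have := finite_of_card hC
  have hp := (Fact.out : p.Prime)
  have hi := index_of_card_prime hC hM
  refine hs.not_both_normal (hN.trans hM.symm) ?_ ?_ ?_
  · rw [hM, hi]
    exact (coprime_of_orderOf hord.out p).symm
  · rw [hM]
    exact (Fact.out : q.Prime).ne_one
  · rw [hi]
    exact (Nat.one_lt_pow hp.ne_zero hp.one_lt).ne'

include hC hs in
theorem IsSimple.not_both_card_pow {N : Subgroup (Multiplicative B)}
    (hNn : N.Normal) (hN : Nat.card N = p ^ p) {M : Subgroup B} (hMn : M.Normal)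
    (hM : Nat.card M = p ^ p) : False := by
  have := finite_of_card hC
  have hp := (Fact.out : p.Prime)
  have hi := index_of_card_pow hC hM
  refine hs.not_both_normal (hN.trans hM.symm) ?_ ?_ ?_
  · rw [hM, hi]
    exact coprime_of_orderOf hord.out p
  · rw [hM]
    exact (Nat.one_lt_pow hp.ne_zero hp.one_lt).ne'
  · rw [hi]
    exact (Fact.out : q.Prime).ne_one

include hC hs in
/-- The additive group of a simple skew brace of order `p ^ p * q` has no normal subgroup `Q` of
order `q`. Otherwise the centralizer of `Q` is a left ideal, hence a subgroup of the multiplicative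
group, in which an element of order `q` acts irreducibly on the Sylow `p`-subgroup. So the
centralizer is everything, and then the Sylow `p`-subgroups of both groups are normal, or it has
order `q`, and then `Q` has `p ^ p > q` automorphisms. -/
theorem IsSimple.not_exists_normal_card_prime :
    ¬ ∃ N : Subgroup (Multiplicative B), N.Normal ∧ Nat.card N = q := by
  rintro ⟨Q, hQn, hQ⟩
  have := finite_of_card hC
  have hfinM : Finite (Multiplicative B) := this
  have hCm : Nat.card (Multiplicative B) = p ^ p * q := hC
  have hq := (Fact.out : q.Prime)
  have hno : ¬ ∃ N : Subgroup B, N.Normal ∧ Nat.card N = q := fun ⟨M, hMn, hM⟩ =>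
    hs.not_both_card_prime hC hQn hQ hMn hM
  obtain ⟨N, hNn, hN⟩ := (exists_normal_card hord.out hC).resolve_left hno
  have hchar : Q.Characteristic := Subgroup.characteristic_of_coprime_index (by
    rw [hQ, index_of_card_prime hCm hQ]
    exact (coprime_of_orderOf hord.out p).symm)
  let K : Subgroup (Multiplicative B) := Subgroup.centralizer (Q : Set (Multiplicative B))
  have hKl : IsLeftIdeal (AddSubgroup.toSubgroup.symm K) :=
    isLeftIdeal_of_characteristic (inferInstanceAs K.Characteristic)
  have hQl : IsLeftIdeal (AddSubgroup.toSubgroup.symm Q) := isLeftIdeal_of_characteristic hchar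
  have hcyc : IsCyclic Q := isCyclic_of_prime_card hQ
  have hQcomm : IsMulCommutative Q := inferInstance
  have hQK : Q ≤ K := Subgroup.le_centralizer Q
  have hQcard : Nat.card hQl.toSubgroup = q := hQ
  obtain ⟨z, hz⟩ := exists_prime_orderOf_dvd_card' (G := hQl.toSubgroup) q hQcard.symm.dvd
  have hzo : orderOf (z : B) = q := by rw [Subgroup.orderOf_coe, hz]
  have hzK : (z : B) ∈ hKl.toSubgroup := hQK z.2
  have hcK : Nat.card hKl.toSubgroup = Nat.card K := rfl
  have hqK : q ∣ Nat.card hKl.toSubgroup := hzo ▸ Subgroup.orderOf_dvd_natCard _ hzK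
  rcases eq_bot_or_eq_of_conj_mem hord.out hC hno hN hzo (M := hKl.toSubgroup ⊓ N) inf_le_right
    (fun x hx => ⟨hKl.toSubgroup.mul_mem (hKl.toSubgroup.mul_mem hzK hx.1)
      (hKl.toSubgroup.inv_mem hzK), hNn.conj_mem x hx.2 z⟩) with h | h
  · have h1 : Nat.card K ∣ q := by
      rw [← hcK, ← index_of_card_pow hC hN]
      exact natCard_dvd_index_of_inf_eq_bot h
    have h2 : p ^ p ∣ K.index := by
      obtain ⟨c, hc⟩ := h1
      refine ⟨c, ?_⟩
      have h3 := K.card_mul_index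
      rw [hCm, hc] at h3
      refine Nat.eq_of_mul_eq_mul_left (Nat.card_pos (α := K)) ?_
      rw [h3]
      ring
    let f : Multiplicative B →* MulAut Q := MulAut.conjNormal
    have h3 : f.ker ≤ K := by
      intro g hg
      rw [Subgroup.mem_centralizer_iff]
      intro x hx
      have h4 := congrArg Subtype.val (DFunLike.congr_fun (MonoidHom.mem_ker.1 hg) ⟨x, hx⟩)
      change g * x * g⁻¹ = x at h4
      exact (mul_inv_eq_iff_eq_mul.1 h4).symm
    have h4 : p ^ p ∣ Nat.card (MulAut Q) := by
      refine (h2.trans (Subgroup.index_dvd_of_le h3)).trans ?_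
      rw [Subgroup.index_ker]
      exact Subgroup.card_subgroup_dvd_card _
    rw [IsCyclic.card_mulAut, hQ, Nat.totient_prime hq] at h4
    have h5 := Nat.le_of_dvd (by have := hq.two_le; omega) h4
    have h6 := lt_pow_of_orderOf hord.out
    omega
  · have h1 : K = ⊤ := by
      rw [← Subgroup.card_eq_iff_eq_top]
      apply Nat.dvd_antisymm (Subgroup.card_subgroup_dvd_card _)
      rw [hCm]
      refine Nat.Coprime.mul_dvd_of_dvd_of_dvd (coprime_of_orderOf hord.out p) ?_ hqK
      rw [← hN, ← h, ← hcK]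
      exact Subgroup.card_dvd_of_le inf_le_left
    obtain ⟨N', hNn', hN'⟩ := exists_normal_of_normalizer_le hord.out hCm hQ
      (le_top.trans h1.ge)
    exact hs.not_both_card_pow hC hNn' hN' hNn hN

include hC hs in
theorem IsSimple.exists_normal_add : ∃ P : Subgroup (Multiplicative B),
    P.Normal ∧ Nat.card P = p ^ p :=
  (exists_normal_card hord.out (H := Multiplicative B) hC).resolve_left
    (hs.not_exists_normal_card_prime hC)

include hC hs in
theorem IsSimple.not_exists_normal_mul : ¬ ∃ P : Subgroup B, P.Normal ∧ Nat.card P = p ^ p := by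
  rintro ⟨M, hMn, hM⟩
  obtain ⟨P, hPn, hP⟩ := hs.exists_normal_add hC
  exact hs.not_both_card_pow hC hPn hP hMn hM

include hC hs in
theorem IsSimple.exists_normal_mul : ∃ Q : Subgroup B, Q.Normal ∧ Nat.card Q = q :=
  (exists_normal_card hord.out hC).resolve_right (hs.not_exists_normal_mul hC)

include hC hs in
/-- Let `Q` be the Sylow `q`-subgroup of the multiplicative group. The common fixed points of the
maps `λ_z`, for `z` in `Q`, form a left ideal, because `Q` is normal. Its order is divisible by `q`,
so it is everything or a Sylow `q`-subgroup of the additive group; in the second case it is `Q`. -/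
theorem IsSimple.lam_eq_or_isLeftIdeal {Q : Subgroup B} (hQn : Q.Normal) (hQ : Nat.card Q = q) :
    (∀ z ∈ Q, ∀ b, lam z b = b) ∨ ∃ I : AddSubgroup B, IsLeftIdeal I ∧ ∀ b, b ∈ I ↔ b ∈ Q := by
  have := finite_of_card hC
  have hfinM : Finite (Multiplicative B) := this
  have hCm : Nat.card (Multiplicative B) = p ^ p * q := hC
  have hq := (Fact.out : q.Prime)
  obtain ⟨P, hPn, hP⟩ := hs.exists_normal_add hC
  have hno := hs.not_exists_normal_card_prime hC
  let I : AddSubgroup B :=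
    { carrier := {b | ∀ z ∈ Q, lam z b = b}
      zero_mem' := fun z _ => lam_zero z
      add_mem' := fun {a b} ha hb z hz => by rw [lam_add, ha z hz, hb z hz]
      neg_mem' := fun {a} ha z hz => by rw [lam_neg, ha z hz] }
  have hI : IsLeftIdeal I := ⟨fun a b hb z hz => by
    have h1 := hb (a⁻¹ * z * a) (by simpa using hQn.conj_mem z hz a⁻¹)
    rw [lam_mul, lam_mul] at h1
    rw [← lam_lam_inv a (lam z (lam a b)), h1]⟩
  obtain ⟨z, hz⟩ := exists_prime_orderOf_dvd_card' (G := Q) q hQ.symm.dvd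
  have hzo : orderOf (z : B) = q := by rw [Subgroup.orderOf_coe, hz]
  have hgen : ∀ y ∈ Q, ∃ n : ℕ, (z : B) ^ n = y := by
    intro y hy
    have h1 : Subgroup.zpowers (z : B) = Q :=
      Subgroup.eq_of_le_of_card_ge (by simp) (by rw [Nat.card_zpowers, hzo, hQ])
    rw [← h1, ← mem_powers_iff_mem_zpowers] at hy
    exact hy
  have hit : ∀ (n : ℕ) b, (lam (z : B))^[n] b = lam ((z : B) ^ n) b := by
    intro n
    induction n with
    | zero => intro b; rw [pow_zero, lam_one]; rfl
    | succ n ih => intro b; rw [Function.iterate_succ_apply', ih, pow_succ', lam_mul]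
  have hqI : q ∣ Nat.card I := by
    have h1 := card_modEq_card_fixed (q := q) (lam (z : B)) (by
      ext b
      rw [hit, ← hzo, pow_orderOf_eq_one, lam_one, id])
    have h2 : Nat.card I = Nat.card {x // lam (z : B) x = x} :=
      Nat.card_congr ⟨fun b => ⟨b, b.2 z z.2⟩, fun b => ⟨b, fun y hy => by
        obtain ⟨n, rfl⟩ := hgen y hy
        rw [← hit]
        exact Function.iterate_fixed b.2 n⟩, fun _ => rfl, fun _ => rfl⟩
    rw [h2, ← Nat.modEq_zero_iff_dvd]
    refine h1.symm.trans ?_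
    rw [hC, Nat.modEq_zero_iff_dvd]
    exact dvd_mul_left _ _
  let J : Subgroup (Multiplicative B) := AddSubgroup.toSubgroup I
  have hqJ : q ∣ Nat.card J := hqI
  obtain ⟨w, hw⟩ := exists_prime_orderOf_dvd_card' (G := J) q hqJ
  have hwo : orderOf (w : Multiplicative B) = q := by rw [Subgroup.orderOf_coe, hw]
  rcases eq_bot_or_eq_of_conj_mem hord.out hCm hno hP hwo (M := J ⊓ P) inf_le_right
    (fun x hx => ⟨J.mul_mem (J.mul_mem w.2 hx.1) (J.inv_mem w.2), hPn.conj_mem x hx.2 w⟩) with h | h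
  · right
    have h1 : Nat.card J ∣ q := by
      rw [← index_of_card_pow hCm hP]
      exact natCard_dvd_index_of_inf_eq_bot h
    have h2 : Nat.card hI.toSubgroup = Nat.card Q :=
      (Nat.dvd_antisymm h1 hqJ).trans hQ.symm
    have h3 : hI.toSubgroup = Q := Subgroup.eq_of_card_eq_of_coprime_index h2 (by
      rw [hQ, index_of_card_prime hC hQ]
      exact (coprime_of_orderOf hord.out p).symm)
    refine ⟨I, hI, fun b => ?_⟩
    rw [← h3]
    rfl
  · left
    have h1 : J = ⊤ := by
      rw [← Subgroup.card_eq_iff_eq_top]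
      apply Nat.dvd_antisymm (Subgroup.card_subgroup_dvd_card _)
      rw [hCm]
      refine Nat.Coprime.mul_dvd_of_dvd_of_dvd (coprime_of_orderOf hord.out p) ?_ hqJ
      rw [← hP, ← h]
      exact Subgroup.card_dvd_of_le inf_le_left
    intro y hy b
    have h2 : Multiplicative.ofAdd b ∈ J := h1 ▸ Subgroup.mem_top _
    exact h2 y hy

variable (B q) in
/-- The condition that tells the model from its opposite: there is a left ideal of order `q` on
which left multiplication is right addition. -/
def HasRightTranslations : Prop :=
  ∃ Q : AddSubgroup B, IsLeftIdeal Q ∧ Nat.card Q = q ∧ ∀ z ∈ Q, ∀ b, z * b = b + z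

include hC hs in
/-- Apply `lam_eq_or_isLeftIdeal` to the skew brace and its opposite. If `Q` is a left ideal of both,
it is normal in the additive group; if `Q` acts trivially in both, it is central in the additive
group. Neither is possible. -/
theorem IsSimple.hasRightTranslations_or :
    HasRightTranslations B q ∨ HasRightTranslations Bᵃᵒᵖ q := by
  have := finite_of_card hC
  have hq := (Fact.out : q.Prime)
  obtain ⟨Q, hQn, hQ⟩ := hs.exists_normal_mul hC
  let Q' : Subgroup Bᵃᵒᵖ :=
    { carrier := {b | b.unop ∈ Q}
      one_mem' := Q.one_mem
      mul_mem' := fun ha hb => Q.mul_mem ha hb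
      inv_mem' := fun ha => Q.inv_mem ha }
  have hQn' : Q'.Normal := ⟨fun n hn g => hQn.conj_mem _ hn g.unop⟩
  have hQ' : Nat.card Q' = q := hQ ▸ Nat.card_congr
    ⟨fun b => ⟨b.1.unop, b.2⟩, fun b => ⟨AddOpposite.op b.1, b.2⟩, fun _ => rfl, fun _ => rfl⟩
  have hC' : Nat.card Bᵃᵒᵖ = p ^ p * q := hC ▸ Nat.card_congr AddOpposite.opEquiv.symm
  rcases hs.lam_eq_or_isLeftIdeal hC hQn hQ with h | ⟨I, hI, hIQ⟩ <;>
    rcases hs.addOpposite.lam_eq_or_isLeftIdeal hC' hQn' hQ' with h' | ⟨J, hJ, hJQ⟩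
  · exfalso
    have : Nontrivial Q := Finite.one_lt_card_iff_nontrivial.1 (hQ ▸ hq.one_lt)
    obtain ⟨z, hz⟩ := exists_ne (1 : Q)
    refine hz (Subtype.ext ?_)
    have h1 := eq_one_of_forall_commute hord.out (H := Multiplicative B) hC
      (hs.not_exists_normal_card_prime hC) (z := .ofAdd (z : B)) fun x => by
        have h2 := mul_eq_add_lam (z : B) x.toAdd
        rw [h z z.2] at h2
        have h3 := mul_eq_add_lam (AddOpposite.op (z : B)) (AddOpposite.op x.toAdd)
        rw [h' _ z.2] at h3
        have h4 : (z : B) * x.toAdd = x.toAdd + z := congrArg AddOpposite.unop h3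
        exact congrArg Multiplicative.ofAdd (h2.symm.trans h4)
    rw [Subgroup.coe_one, one_eq_zero]
    exact h1
  · right
    refine ⟨J, hJ, ?_, fun z hz b => ?_⟩
    · rw [← hQ']
      exact Nat.card_congr (Equiv.subtypeEquivRight hJQ)
    · have h2 := mul_eq_add_lam z.unop b.unop
      rw [h z.unop ((hJQ z).1 hz)] at h2
      exact congrArg AddOpposite.op h2
  · left
    refine ⟨I, hI, ?_, fun z hz b => ?_⟩
    · rw [← hQ]
      exact Nat.card_congr (Equiv.subtypeEquivRight hIQ)
    · have h3 := mul_eq_add_lam (AddOpposite.op z) (AddOpposite.op b)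
      rw [h' (AddOpposite.op z) ((hIQ z).1 hz)] at h3
      exact congrArg AddOpposite.unop h3
  · exfalso
    refine hs.not_exists_normal_card_prime hC ⟨AddSubgroup.toSubgroup I, ⟨fun b hb a => ?_⟩, ?_⟩
    · have h1 : lam a.toAdd⁻¹ b.toAdd ∈ I := hI.lam_mem _ _ hb
      have h2 := hJ.lam_mem (AddOpposite.op a.toAdd) (AddOpposite.op (lam a.toAdd⁻¹ b.toAdd))
        ((hJQ _).2 ((hIQ _).1 h1))
      have h3 := (hIQ _).2 ((hJQ _).1 h2)
      change a.toAdd * lam a.toAdd⁻¹ b.toAdd + -a.toAdd ∈ I at h3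
      rw [mul_eq_add_lam, lam_lam_inv] at h3
      exact h3
    · rw [← hQ]
      exact Nat.card_congr (Equiv.subtypeEquivRight hIQ)

end Simple

end SkewBrace

/-! ### Coordinates on the additive group -/

section Coordinates

variable {p q : ℕ} [Fact p.Prime] [Fact q.Prime] [hord : Fact (orderOf (p : ZMod q) = p)]

local notation "χ" => rootChar p q

/-- The additive group of order `p ^ p * q`, without normal subgroup of order `q`, in coordinates:
the Sylow `p`-subgroup `P` is a line over the field of order `p ^ p`, and a subgroup `Q` of order
`q` acts on it as the group of `q`-th roots of unity. The vector that gets coordinate `1` can be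
prescribed. -/
theorem exists_coordinates {A : Type*} [AddGroup A] (hA : Nat.card A = p ^ p * q)
    (hno : ¬ ∃ N : Subgroup (Multiplicative A), N.Normal ∧ Nat.card N = q)
    {P : AddSubgroup A} (hPn : (AddSubgroup.toSubgroup P).Normal) (hP : Nat.card P = p ^ p)
    {Q : AddSubgroup A} (hQ : Nat.card Q = q) {v₀ : A} (hv₀P : v₀ ∈ P) (hv₀ : v₀ ≠ 0) :
    ∃ (e : GaloisField p p →+ A) (ι : ZMod q →+ A), Function.Injective e ∧ Function.Injective ι ∧
      (∀ b, b ∈ P ↔ ∃ x, e x = b) ∧ (∀ b, b ∈ Q ↔ ∃ k, ι k = b) ∧ e 1 = v₀ ∧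
      ∀ k x, ι k + e x = e (χ k * x) + ι k := by
  have hq := (Fact.out : q.Prime)
  have hp := (Fact.out : p.Prime)
  have hAm : Nat.card (Multiplicative A) = p ^ p * q := hA
  have hfin : Finite A := finite_of_card hA
  have hPm : Nat.card (AddSubgroup.toSubgroup P) = p ^ p := hP
  obtain ⟨hcomm, -⟩ := commute_and_pow_eq_one hord.out hAm hno hPm
  obtain ⟨z', hz'⟩ := exists_prime_addOrderOf_dvd_card' (G := Q) q hQ.symm.dvd
  obtain ⟨z, hzQ, hz⟩ : ∃ z ∈ Q, addOrderOf z = q := ⟨z', z'.2, by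
    rw [AddSubgroup.addOrderOf_coe, hz']⟩
  have hzm : orderOf (Multiplicative.ofAdd z) = q := by rw [orderOf_ofAdd_eq_addOrderOf, hz]
  let : AddCommGroup P :=
    { (inferInstance : AddGroup P) with
      add_comm := fun a b => Subtype.ext (hcomm (.ofAdd a) a.2 (.ofAdd b) b.2) }
  -- conjugation by `z` on `P`
  let T : AddMonoid.End P :=
    { toFun := fun x => ⟨z + x + -z, hPn.conj_mem (.ofAdd x) x.2 (.ofAdd z)⟩
      map_zero' := Subtype.ext (by simp)
      map_add' := fun x y => Subtype.ext (by simp [add_assoc]) }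
  have hTpow : ∀ (n : ℕ) (x : P), (((T ^ n) x : P) : A) = n • z + x + -(n • z) := by
    intro n
    induction n with
    | zero => intro x; simp
    | succ n ih =>
      intro x
      rw [pow_succ']
      change z + (((T ^ n) x : P) : A) + -z = _
      rw [ih, succ_nsmul']
      simp only [neg_add_rev, add_assoc]
  have hTq : T ^ q = 1 := by
    ext x
    rw [hTpow, ← hz, addOrderOf_nsmul_eq_zero]
    simp
  have hT1 : T ≠ 1 := by
    intro h
    have h1 := congrArg Subtype.val (DFunLike.congr_fun h ⟨v₀, hv₀P⟩)
    change z + v₀ + -z = v₀ at h1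
    exact hv₀ (eq_one_of_commute_of_orderOf hord.out hAm hno hPm hzm (x := .ofAdd v₀) hv₀P
      (congrArg Multiplicative.ofAdd (add_neg_eq_iff_eq_add.1 h1)))
  have hirr : ∀ W : AddSubgroup P, (∀ x ∈ W, T x ∈ W) → W = ⊥ ∨ W = ⊤ := by
    intro W hW
    rcases eq_bot_or_eq_of_conj_mem hord.out hAm hno hPm hzm
      (M := AddSubgroup.toSubgroup (W.map P.subtype)) (by
        rintro _ ⟨x, hx, rfl⟩
        exact x.2) (by
        rintro _ ⟨x, hx, rfl⟩
        exact ⟨T x, hW x hx, rfl⟩) with h | h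
    · left
      rw [eq_bot_iff]
      intro x hx
      have h1 : Multiplicative.ofAdd (x : A) ∈ AddSubgroup.toSubgroup (W.map P.subtype) :=
        ⟨x, hx, rfl⟩
      rw [h, Subgroup.mem_bot] at h1
      exact Subtype.ext h1
    · right
      rw [eq_top_iff]
      intro x _
      have h1 : Multiplicative.ofAdd (x : A) ∈ AddSubgroup.toSubgroup (W.map P.subtype) :=
        h ▸ x.2
      obtain ⟨y, hy, hyx⟩ := h1
      have : y = x := Subtype.ext hyx
      exact this ▸ hy
  obtain ⟨hmod, ζ, hζq, hζ1, hζ⟩ := exists_module_galoisField hord.out hP T hTq hT1 hirr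
  obtain ⟨k₀, hk₀⟩ := exists_rootChar_eq hζq
  have hk₀0 : k₀ ≠ 0 := by
    rintro rfl
    exact hζ1 (by rw [← hk₀, AddChar.map_zero_eq_one])
  let e : GaloisField p p →+ A :=
    { toFun := fun x => ((x • (⟨v₀, hv₀P⟩ : P) : P) : A)
      map_zero' := by rw [zero_smul]; rfl
      map_add' := fun x y => by rw [add_smul]; rfl }
  have heinj : Function.Injective e := by
    intro x y hxy
    exact smul_left_injective (GaloisField p p) (m := (⟨v₀, hv₀P⟩ : P))
      (fun h => hv₀ (congrArg Subtype.val h)) (Subtype.ext hxy)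
  let ι₀ : ZMod q →+ A := ZMod.lift q ⟨zmultiplesHom A z, by
    change (q : ℤ) • z = 0
    rw [natCast_zsmul, ← hz, addOrderOf_nsmul_eq_zero]⟩
  have hι₀ : ∀ n : ℕ, ι₀ n = n • z := by
    intro n
    have h1 := ZMod.lift_coe q ⟨zmultiplesHom A z, by
      change (q : ℤ) • z = 0
      rw [natCast_zsmul, ← hz, addOrderOf_nsmul_eq_zero]⟩ (n : ℤ)
    rw [Int.cast_natCast] at h1
    refine h1.trans ?_
    change (n : ℤ) • z = n • z
    rw [natCast_zsmul]
  -- rescale so that `1` corresponds to the root of unity `χ 1`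
  let ι : ZMod q →+ A := ι₀.comp (AddMonoidHom.mulRight k₀⁻¹)
  have hι : ∀ k, ι k = (k * k₀⁻¹).val • z := by
    intro k
    rw [← hι₀, ZMod.natCast_zmod_val]
    rfl
  have hιQ : ∀ k, ι k ∈ Q := fun k => by
    rw [hι]
    exact Q.nsmul_mem hzQ _
  have hιinj : Function.Injective ι := by
    rw [injective_iff_map_eq_zero]
    intro k hk
    rw [hι, ← addOrderOf_dvd_iff_nsmul_eq_zero, hz, ← ZMod.natCast_eq_zero_iff,
      ZMod.natCast_zmod_val] at hk
    exact (mul_eq_zero.1 hk).resolve_right (inv_ne_zero hk₀0)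
  refine ⟨e, ι, heinj, hιinj, fun b => ⟨fun hb => ?_, ?_⟩, fun b => ⟨fun hb => ?_, ?_⟩, ?_,
    fun k x => ?_⟩
  · have h1 : Function.Bijective (fun x : GaloisField p p => (⟨e x, Subtype.prop _⟩ : P)) := by
      rw [Nat.bijective_iff_injective_and_card]
      exact ⟨fun x y hxy => heinj (congrArg Subtype.val hxy), by
        rw [natCard_galoisField_self, hP]⟩
    obtain ⟨x, hx⟩ := h1.2 ⟨b, hb⟩
    exact ⟨x, congrArg Subtype.val hx⟩
  · rintro ⟨x, rfl⟩
    exact Subtype.prop _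
  · have h1 : Function.Bijective (fun k : ZMod q => (⟨ι k, hιQ k⟩ : Q)) := by
      rw [Nat.bijective_iff_injective_and_card]
      exact ⟨fun x y hxy => hιinj (congrArg Subtype.val hxy), by rw [Nat.card_zmod, hQ]⟩
    obtain ⟨x, hx⟩ := h1.2 ⟨b, hb⟩
    exact ⟨x, congrArg Subtype.val hx⟩
  · rintro ⟨k, rfl⟩
    exact hιQ k
  · change ((1 : GaloisField p p) • (⟨v₀, hv₀P⟩ : P) : P).1 = v₀
    rw [one_smul]
  · have h1 : ∀ (n : ℕ) (v : P), (T ^ n) v = ζ ^ n • v := by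
      intro n
      induction n with
      | zero => intro v; rw [pow_zero, pow_zero, one_smul]; rfl
      | succ n ih =>
        intro v
        rw [pow_succ']
        change T ((T ^ n) v) = _
        rw [ih, ← hζ, smul_smul, pow_succ']
    have h2 : ζ ^ (k * k₀⁻¹).val = χ k := by
      rw [← hk₀, ← AddChar.map_nsmul_eq_pow, nsmul_eq_mul, ZMod.natCast_zmod_val,
        inv_mul_cancel_right₀ hk₀0]
    have h3 := hTpow (k * k₀⁻¹).val (x • ⟨v₀, hv₀P⟩)
    rw [h1, h2, smul_smul, ← hι] at h3
    change e (χ k * x) = ι k + e x + -ι k at h3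
    rw [h3, neg_add_cancel_right]

end Coordinates

/-! ### Classification -/

namespace SkewBrace

variable {B : Type*} [SkewBrace B] {p q : ℕ} [Fact p.Prime] [Fact q.Prime]
  [hord : Fact (orderOf (p : ZMod q) = p)]

local notation "χ" => rootChar p q

/-- A left ideal of `p`-power order acts on itself with a nonzero fixed point. -/
theorem IsLeftIdeal.exists_fixed [Finite B] {P : AddSubgroup B} (hPl : IsLeftIdeal P)
    (hP : Nat.card P = p ^ p) : ∃ v ∈ P, v ≠ 0 ∧ ∀ x ∈ P, lam x v = v := by
  let : MulAction hPl.toSubgroup P :=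
    { smul := fun x v => ⟨lam (x : B) v, hPl.lam_mem x v v.2⟩
      one_smul := fun v => Subtype.ext (lam_one _)
      mul_smul := fun x y v => Subtype.ext (lam_mul _ _ _) }
  have hpg : IsPGroup p hPl.toSubgroup := IsPGroup.of_card (n := p) hP
  obtain ⟨v, hv, hv0⟩ := hpg.exists_fixed_point_of_prime_dvd_card_of_fixed_point P
    (by rw [hP]; exact dvd_pow_self p (Fact.out : p.Prime).ne_zero)
    (a := 0) (fun x => Subtype.ext (lam_zero _))
  exact ⟨v, v.2, fun h => hv0 (Subtype.ext h.symm), fun x hx =>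
    congrArg Subtype.val (hv ⟨x, hx⟩)⟩

/-- In coordinates as in `exists_coordinates`, with coordinate `1` for a fixed vector, an
automorphism `λ_b` is a power of the Frobenius automorphism, because it normalizes the action of the
roots of unity. -/
theorem exists_lam_eq {P Q : AddSubgroup B} (hPl : IsLeftIdeal P) (hQl : IsLeftIdeal Q)
    {e : GaloisField p p →+ B} {ι : ZMod q →+ B} (he : Function.Injective e)
    (heP : ∀ b, b ∈ P ↔ ∃ x, e x = b) (hιQ : ∀ b, b ∈ Q ↔ ∃ k, ι k = b)
    (hconj : ∀ k x, ι k + e x = e (χ k * x) + ι k) {b : B} (hb : lam b (e 1) = e 1) :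
    ∃ t : ZMod p, (∀ y, lam b (e y) = e (frobPow t y)) ∧
      ∀ k, lam b (ι k) = ι (frobExp q t * k) := by
  have h1 : ∀ y, ∃ y', e y' = lam b (e y) := fun y =>
    (heP _).1 (hPl.lam_mem b _ ((heP _).2 ⟨y, rfl⟩))
  choose g₀ hg₀ using h1
  let g : GaloisField p p →+ GaloisField p p := AddMonoidHom.mk' g₀ fun x y => he (by
    rw [map_add, hg₀, hg₀, hg₀, map_add, lam_add])
  have hg : ∀ y, lam b (e y) = e (g y) := fun y => (hg₀ y).symm
  have hginj : Function.Injective g := fun x y hxy => he (by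
    rw [← lam_inv_lam b (e x), ← lam_inv_lam b (e y), hg, hg, hxy])
  have hfin : Finite (GaloisField p p) := inferInstance
  have hgsurj : Function.Surjective g := Finite.surjective_of_injective hginj
  have h2 : ∀ k, ∃ k', ι k' = lam b (ι k) := fun k =>
    (hιQ _).1 (hQl.lam_mem b _ ((hιQ _).2 ⟨k, rfl⟩))
  choose h hh using h2
  have hsmul : ∀ k x, g (χ k • x) = χ (h k) • g x := by
    intro k x
    have h3 := congrArg (lam b) (hconj k x)
    rw [lam_add, lam_add, hg, hg, ← hh, hconj] at h3
    exact (he (add_right_cancel h3)).symm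
  obtain ⟨t, ht⟩ := exists_frobPow_smul hord.out hgsurj (rootChar_pow 1) rootChar_one_ne_one _
    (hsmul 1)
  have hg1 : g 1 = 1 := he (by rw [← hg, hb])
  have hgt : ∀ y, g y = frobPow t y := fun y => by
    have h3 := ht y 1
    rwa [smul_eq_mul, mul_one, hg1, smul_eq_mul, mul_one] at h3
  refine ⟨t, fun y => by rw [hg, hgt], fun k => ?_⟩
  have h3 := hsmul k 1
  rw [smul_eq_mul, mul_one, hg1, smul_eq_mul, mul_one, hgt, frobPow_rootChar] at h3
  rw [rootChar_injective h3, hh]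

/-- A simple skew brace of order `p ^ p * q` in which left multiplication by the elements of a left
ideal of order `q` is right addition is isomorphic to the model. -/
theorem IsSimple.nonempty_iso (hC : Nat.card B = p ^ p * q) (hs : IsSimple B)
    (hr : HasRightTranslations B q) : Nonempty (B ≃+* TraceBrace p q) := by
  obtain ⟨Q, hQl, hQ, hQt⟩ := hr
  have hfin := finite_of_card hC
  have hfinM : Finite (Multiplicative B) := hfin
  have hp := (Fact.out : p.Prime)
  have hCm : Nat.card (Multiplicative B) = p ^ p * q := hC
  have hno := hs.not_exists_normal_card_prime hC
  obtain ⟨P', hPn, hP'⟩ := hs.exists_normal_add hC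
  obtain ⟨P, rfl⟩ := AddSubgroup.toSubgroup.surjective P'
  have hP : Nat.card P = p ^ p := hP'
  have hPl : IsLeftIdeal P := isLeftIdeal_of_characteristic
    (Subgroup.characteristic_of_coprime_index (by
      rw [hP', index_of_card_pow hCm hP']
      exact coprime_of_orderOf hord.out p))
  obtain ⟨v, hvP, hv0, hv⟩ := hPl.exists_fixed hP
  obtain ⟨e, ι, he, hι, heP, hιQ, he1, hconj⟩ := exists_coordinates hC hno hPn hP hQ hvP hv0
  -- every element is a sum of an element of `P` and an element of `Q`
  have hbij : ∀ e' : GaloisField p p →+ B, Function.Injective e' →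
      Function.Bijective (fun a : TraceBrace p q => e' a.vec + ι a.exp) := by
    intro e' he'
    have hfinT : Finite (TraceBrace p q) := finite_of_card TraceBrace.natCard_traceBrace
    rw [Nat.bijective_iff_injective_and_card]
    refine ⟨fun a b hab => ?_, TraceBrace.natCard_traceBrace.trans hC.symm⟩
    have h1 : e' (-b.vec + a.vec) = ι (b.exp - a.exp) := by
      rw [map_add, map_neg, map_sub, neg_add_eq_iff_eq_add, ← add_sub_assoc]
      exact eq_sub_of_add_eq hab
    have h2 : p • ι (b.exp - a.exp) = 0 := by
      rw [← h1, ← map_nsmul, nsmul_eq_mul, CharP.cast_eq_zero, zero_mul, map_zero]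
    rw [← map_nsmul, ← map_zero ι, hι.eq_iff, nsmul_eq_mul] at h2
    have h3 := (mul_eq_zero.1 h2).resolve_left (natCast_ne_zero_of_orderOf hord.out)
    rw [h3, map_zero, ← map_zero e', he'.eq_iff] at h1
    exact TraceBrace.ext (sub_eq_zero.1 h3).symm (neg_add_eq_zero.1 h1).symm
  have hιt : ∀ k b, ι k * b = b + ι k := fun k => hQt _ ((hιQ _).2 ⟨k, rfl⟩)
  have hlam : ∀ x, ∃ t : ZMod p, (∀ y, lam (e x) (e y) = e (frobPow t y)) ∧
      ∀ k, lam (e x) (ι k) = ι (frobExp q t * k) := fun x =>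
    exists_lam_eq hPl hQl he heP hιQ hconj (by rw [he1]; exact hv _ ((heP _).2 ⟨x, rfl⟩))
  choose f hfe hfι using hlam
  have hcocycle : ∀ x y, f (x + frobPow (f x) y) = f x + f y := by
    intro x y
    apply frobPow_injective
    ext w
    apply he
    rw [← hfe, map_add e, ← hfe x y, ← mul_eq_add_lam, lam_mul, hfe, hfe, frobPow_add_apply]
  -- otherwise `P` would be normal in the multiplicative group
  have hne : ∃ x, f x ≠ 0 := by
    by_contra! h0
    refine hs.not_exists_normal_mul hC ⟨hPl.toSubgroup, ⟨fun n hn g => ?_⟩, hP⟩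
    have hcomm : ∀ k, ∀ b ∈ hPl.toSubgroup, ι k * b = b * ι k := by
      intro k b hb
      obtain ⟨x, rfl⟩ := (heP b).1 hb
      rw [hιt, mul_eq_add_lam, hfι, h0, frobExp_zero, one_mul]
    obtain ⟨a, rfl⟩ := (hbij e he).2 g
    have ha : e a.vec ∈ hPl.toSubgroup := (heP _).2 ⟨_, rfl⟩
    have h1 : e a.vec * n * (e a.vec)⁻¹ ∈ hPl.toSubgroup :=
      hPl.toSubgroup.mul_mem (hPl.toSubgroup.mul_mem ha hn) (hPl.toSubgroup.inv_mem ha)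
    have h2 : (e a.vec + ι a.exp) * n * (e a.vec + ι a.exp)⁻¹ =
        e a.vec * n * (e a.vec)⁻¹ := by
      rw [← hιt, mul_inv_rev, ← mul_assoc, mul_inv_eq_iff_eq_mul, mul_assoc (ι a.exp),
        mul_assoc (ι a.exp), hcomm _ _ h1]
    change (e a.vec + ι a.exp) * n * (e a.vec + ι a.exp)⁻¹ ∈ hPl.toSubgroup
    rw [h2]
    exact h1
  obtain ⟨c, hc, hfc⟩ := exists_eq_trace_of_cocycle hcocycle hne
  have hcF : algebraMap (ZMod p) (GaloisField p p) c ≠ 0 :=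
    (map_ne_zero (algebraMap (ZMod p) (GaloisField p p))).2 hc
  -- rescale the coordinate on `P` by an element of the prime field
  let d := algebraMap (ZMod p) (GaloisField p p) c⁻¹
  have hd : algebraMap (ZMod p) (GaloisField p p) c * d = 1 := by
    rw [← map_mul, mul_inv_cancel₀ hc, map_one]
  let e' : GaloisField p p →+ B := e.comp (AddMonoidHom.mulLeft d)
  have he'inj : Function.Injective e' := fun x y hxy =>
    mul_left_cancel₀ (right_ne_zero_of_mul_eq_one hd) (he hxy)
  have hfd : ∀ x, f (d * x) = tr p x := fun x => by rw [hfc, ← mul_assoc, hd, one_mul]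
  have he'e : ∀ x y, lam (e' x) (e' y) = e' (frobPow (tr p x) y) := by
    intro x y
    change lam (e (d * x)) (e (d * y)) = e (d * _)
    rw [hfe, hfd, map_mul, frobPow_algebraMap]
  have he'ι : ∀ x k, lam (e' x) (ι k) = ι (frobExp q (tr p x) * k) := by
    intro x k
    change lam (e (d * x)) (ι k) = _
    rw [hfι, hfd]
  have he'conj : ∀ k x, ι k + e' x = e' (χ k * x) + ι k := by
    intro k x
    change ι k + e (d * x) = e (d * _) + ι k
    rw [hconj, mul_left_comm]
  refine ⟨(RingEquiv.symm { Equiv.ofBijective _ (hbij e' he'inj) with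
    map_mul' := fun a b => ?_
    map_add' := fun a b => ?_ } : B ≃+* TraceBrace p q)⟩
  · change e' (a.vec + frobPow (tr p a.vec) b.vec) + ι (a.exp + frobExp q (tr p a.vec) * b.exp) =
      (e' a.vec + ι a.exp) * (e' b.vec + ι b.exp)
    rw [← hιt a.exp (e' a.vec), mul_assoc, hιt, mul_eq_add_lam, lam_add, he'e, he'ι, map_add,
      add_comm a.exp, map_add]
    simp only [add_assoc]
  · change e' (a.vec + χ a.exp * b.vec) + ι (a.exp + b.exp) =
      e' a.vec + ι a.exp + (e' b.vec + ι b.exp)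
    rw [map_add, map_add, add_assoc (e' a.vec), ← add_assoc (e' (_ * _)), ← he'conj]
    simp only [add_assoc]

/-- Every simple skew brace of order `p ^ p * q` is isomorphic to the model or to its opposite. -/
theorem IsSimple.nonempty_iso_or (hC : Nat.card B = p ^ p * q) (hs : IsSimple B) :
    Nonempty (B ≃+* TraceBrace p q) ∨ Nonempty (B ≃+* (TraceBrace p q)ᵃᵒᵖ) := by
  rcases hs.hasRightTranslations_or hC with h | h
  · exact .inl (hs.nonempty_iso hC h)
  · have hC' : Nat.card Bᵃᵒᵖ = p ^ p * q := hC ▸ Nat.card_congr AddOpposite.opEquiv.symm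
    obtain ⟨e⟩ := hs.addOpposite.nonempty_iso hC' h
    exact .inr ⟨opOpIso.trans (opIso e)⟩

end SkewBrace

theorem theorem1p1 (p q : ℕ) (hp : p.Prime) (hq : q.Prime)
    (hpq : q ∣ (p ^ p - 1) / (p - 1)) :
    -- there are exactly two simple skew braces of order `n = p ^ p * q`, opposite to each other
    (∃ (B : Type) (_ : SkewBrace B),
      Nat.card B = p ^ p * q ∧ SkewBrace.IsSimple B ∧
      Nat.card Bᵃᵒᵖ = p ^ p * q ∧ SkewBrace.IsSimple Bᵃᵒᵖ ∧
      IsEmpty (B ≃+* Bᵃᵒᵖ) ∧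
      ∀ (C : Type u) [SkewBrace C], Nat.card C = p ^ p * q → SkewBrace.IsSimple C →
        Nonempty (C ≃+* B) ∨ Nonempty (C ≃+* Bᵃᵒᵖ)) ∧
    -- their additive groups are isomorphic to `C_p ^ p ⋊ C_q`, with a nontrivial action
    (∃ φ : Multiplicative (ZMod q) →* MulAut (Multiplicative (Fin p → ZMod p)),
      φ ≠ 1 ∧
      ∀ (C : Type u) [SkewBrace C], Nat.card C = p ^ p * q → SkewBrace.IsSimple C →
        Nonempty (Multiplicative C ≃*
          Multiplicative (Fin p → ZMod p) ⋊[φ] Multiplicative (ZMod q))) ∧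
    -- their multiplicative groups are isomorphic to `C_q ⋊ P`, where `P` has order `p ^ p`
    -- and acts through the group generated by an automorphism of `C_q` of order `p`
    (∃ (P : Type) (_ : Group P) (ψ : P →* MulAut (Multiplicative (ZMod q))),
      Nat.card P = p ^ p ∧
      (∃ α : MulAut (Multiplicative (ZMod q)), orderOf α = p ∧ ψ.range = Subgroup.zpowers α) ∧
      ∀ (C : Type u) [SkewBrace C], Nat.card C = p ^ p * q → SkewBrace.IsSimple C →
        Nonempty (C ≃* Multiplicative (ZMod q) ⋊[ψ] P)) ∧
    -- their automorphism groups are cyclic of order `p`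
    (∀ (C : Type u) [SkewBrace C], Nat.card C = p ^ p * q → SkewBrace.IsSimple C →
      IsCyclic (RingAut C) ∧ Nat.card (RingAut C) = p) := by
  have : Fact p.Prime := ⟨hp⟩
  have : Fact q.Prime := ⟨hq⟩
  have : Fact (orderOf (p : ZMod q) = p) := ⟨orderOf_natCast_of_dvd hpq⟩
  refine ⟨⟨TraceBrace p q, inferInstance, TraceBrace.natCard_traceBrace, TraceBrace.isSimple,
    (Nat.card_congr AddOpposite.opEquiv.symm).trans TraceBrace.natCard_traceBrace,
    TraceBrace.isSimple.addOpposite, TraceBrace.isEmpty_iso_opposite,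
    fun C _ hC hs => hs.nonempty_iso_or hC⟩, ?_, ?_, fun C _ hC hs => ?_⟩
  · obtain ⟨φ, hφ, ⟨i⟩⟩ := TraceBrace.exists_additive_iso p q
    refine ⟨φ, hφ, fun C _ hC hs => ?_⟩
    rcases hs.nonempty_iso_or (p := p) (q := q) hC with ⟨⟨e⟩⟩ | ⟨⟨e⟩⟩
    · exact ⟨(AddEquiv.toMultiplicative e.toAddEquiv).trans i⟩
    · -- a group is isomorphic to its opposite by inversion
      exact ⟨(AddEquiv.toMultiplicative
        (e.toAddEquiv.trans (AddEquiv.neg' (TraceBrace p q)).symm)).trans i⟩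
  · obtain ⟨P, hP, ψ, hcard, hα, ⟨i⟩⟩ := TraceBrace.exists_multiplicative_iso p q
    refine ⟨P, hP, ψ, hcard, hα, fun C _ hC hs => ?_⟩
    rcases hs.nonempty_iso_or (p := p) (q := q) hC with ⟨⟨e⟩⟩ | ⟨⟨e⟩⟩
    · exact ⟨e.toMulEquiv.trans i⟩
    · exact ⟨(e.toMulEquiv.trans AddOpposite.opMulEquiv.symm).trans i⟩
  · obtain ⟨h1, h2⟩ := TraceBrace.isCyclic_and_card_ringAut p q
    have h3 : Nonempty (RingAut C ≃* RingAut (TraceBrace p q)) := by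
      rcases hs.nonempty_iso_or (p := p) (q := q) hC with ⟨⟨e⟩⟩ | ⟨⟨e⟩⟩
      · exact ⟨autCongr e⟩
      · exact ⟨(autCongr e).trans autOpposite⟩
    obtain ⟨i⟩ := h3
    exact ⟨isCyclic_of_surjective i.symm i.symm.surjective, by rw [Nat.card_congr i.toEquiv, h2]⟩
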